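/- Conventions. $|\cdot|$ is the Euclidean norm and $B(y,r)$ the open Euclidean ball. A name of a point $x\in\mathbb{R}^n$ is a sequence $(q_j)_{j\in\mathbb N}$ in $\mathbb{Q}^n$ with $|x-q_j|<2^{-j}$ for all $j$. A name of an open set $U\subseteq\mathbb{R}^n$ is a list of rational centers $z_j\in\mathbb{Q}^n$ and rational radii $r_j$ with $U=\bigcup_j B(z_j,r_j)$ (balls of radius $\le 0$ are empty). A point is computable, respectively an open set is r.e. open, if it has a computable name. A function $f:D\to\mathbb{R}^m$ with $D\subseteq\mathbb{R}^n$ is computable if some Type-2 machine converts every name of every $x\in D$ into a name of $f(x)$; a matrix-valued function is computable if it is computable as a function into $\mathbb{R}^{mn}$. A partial multi-valued mapping $I$ from pairs $(U,x_0)$ to $\mathbb{N}$ is computable if some Type-2 machine, given any name of $U$ and any name of $x_0$, where $I(U,x_0)\neq\emptyset$, outputs some $k\in I(U,x_0)$ (which may depend on the names). For $U\subseteq\mathbb{R}^n$ open, $f:U\to\mathbb{R}^m$ differentiable and $x_0\in U$, a local right inverse of $f$ at $x_0$ into $V\subseteq U$ on $B(f(x_0),\delta)$ is a $C^1$ function $g:B(f(x_0),\delta)\to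 V$ with $g(f(x_0))=x_0$ and $f(g(y))=y$ for all $y\in B(f(x_0),\delta)$. Theorem 4 (Effectivized Inverse Function Theorem). (1) Let $U\subseteq\mathbb{R}^n$ be r.e. open, let $f:U\to\mathbb{R}^m$ be computable and differentiable with computable derivative $f':U\to\mathbb{R}^{m\times n}$, and let $x_0\in U$ be computable with $\operatorname{rank} f'(x_0)=m$. Then there are a rational $\delta>0$ and a local right inverse $g:B(f(x_0),\delta)\to U$ of $f$ at $x_0$ such that $g$ and its derivative $g'$ are computable. (2) Let $X\subseteq\mathbb{R}^n$ be r.e. open and let $f:X\to\mathbb{R}^m$ be computable and continuously differentiable with computable derivative $f'$. Let $I$ be the multi-valued mapping with $k\in I(U,x_0)$ if and only if $U$ is open, $x_0\in U\subseteq X$, $\operatorname{rank} f'(x_0)=m$, and there is a local right inverse of $f$ at $x_0$ into $U$ on $B(f(x_0),2^{-k})$. Then $I(U,x_0)\neq\emptyset$ for all open $U\subseteq X$ and all $x_0\in U$ with $\operatorname{rank} f'(x_0)=m$, and $I$ is computable. -/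

import Mathlib

namespace TTE

/-! ### Type-2 computability on sequences over countable alphabets -/

/-- The prefix of length `k` of an infinite sequence `p`. -/
def pre {α : Type} (p : ℕ → α) (k : ℕ) : List α := (List.range k).map p

/-- A monotone word function: `h w i = some b` means that, having read the finite input prefix `w`,
the machine has written the symbol `b` in cell `i` of its one-way output tape. Symbols once
written are never revoked when more input is read. -/
def IsMonotoneWord {α β : Type} (h : List α → ℕ → Option β) : Prop :=
  ∀ (w w' : List α) (i : ℕ) (b : β), w <+: w' → h w i = some b → h w' i = some b

/-- On the infinite input `p`, the word function `h` produces the infinite output `q`. -/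
def Produces {α β : Type} (h : List α → ℕ → Option β) (p : ℕ → α) (q : ℕ → β) : Prop :=
  ∀ i, ∃ k, h (pre p k) i = some (q i)

/-- A representation of `X` over the alphabet `α`: `δ p x` says that the infinite sequence `p`
is a name of `x`. -/
abbrev Rep (α X : Type) := (ℕ → α) → X → Prop

/-- `x` is a computable element: it has a computable name. -/
def IsComputableElem {α X : Type} [Primcodable α] (δ : Rep α X) (x : X) : Prop :=
  ∃ p : ℕ → α, Computable p ∧ δ p x

/-- The partial multi-valued mapping with graph `R`, defined at those `x` that are related to some
`y`, is `(δ ⇉ γ)`-computable: one Type-2 machine maps every name of every such `x` to a name of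
some `y` with `R x y`. -/
def MultiComputable {α β X Y : Type} [Primcodable α] [Primcodable β]
    (δ : Rep α X) (γ : Rep β Y) (R : X → Y → Prop) : Prop :=
  ∃ h : List α → ℕ → Option β, Computable₂ h ∧ IsMonotoneWord h ∧
    ∀ (p : ℕ → α) (x : X), δ p x → (∃ y, R x y) →
      ∃ (q : ℕ → β) (y : Y), Produces h p q ∧ γ q y ∧ R x y

/-- The single-valued function `f` with domain `D` is `(δ → γ)`-computable. -/
def ComputableOn {α β X Y : Type} [Primcodable α] [Primcodable β]
    (δ : Rep α X) (γ : Rep β Y) (D : Set X) (f : X → Y) : Prop :=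
  MultiComputable δ γ (fun x y => x ∈ D ∧ y = f x)

/-- Names of pairs: both names are given in parallel. -/
def prodRep {α β X Y : Type} (δ : Rep α X) (γ : Rep β Y) : Rep (α × β) (X × Y) :=
  fun p z => δ (fun j => (p j).1) z.1 ∧ γ (fun j => (p j).2) z.2

/-- Natural numbers: a name of `k` is a sequence starting with `k`. -/
def natRep : Rep ℕ ℕ := fun p k => p 0 = k

/-! ### The standard representations of Euclidean space and of its open subsets -/

/-- Euclidean space `ℝⁿ`. -/
abbrev E (n : ℕ) := EuclideanSpace ℝ (Fin n)

/-- Codes of rational numbers. -/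
abbrev RatCode := ℕ × ℕ × ℕ

/-- The notation `(a, b, c) ↦ (a - b) / (c + 1)` of the rational numbers. -/
def ratOf (t : RatCode) : ℚ := ((t.1 : ℚ) - (t.2.1 : ℚ)) / ((t.2.2 : ℚ) + 1)

/-- The rational vector with the given coordinate codes. -/
noncomputable def vecOf {n : ℕ} (c : Fin n → RatCode) : E n :=
  WithLp.toLp 2 (fun i => ((ratOf (c i) : ℚ) : ℝ))

/-- The Cauchy representation of `ℝⁿ`: names are sequences of rational vectors converging fast. -/
def cauchyRep (n : ℕ) : Rep (Fin n → RatCode) (E n) :=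
  fun p x => ∀ j : ℕ, ‖x - vecOf (p j)‖ < (2 : ℝ)⁻¹ ^ j

/-- The representation of the open subsets of `ℝⁿ` by lists of open rational balls whose union is
the given set. A ball of radius `≤ 0` is empty, so the empty set has names, too. -/
def openRep (n : ℕ) : Rep ((Fin n → RatCode) × RatCode) (TopologicalSpace.Opens (E n)) :=
  fun p U => (U : Set (E n)) = ⋃ j : ℕ, Metric.ball (vecOf (p j).1) ((ratOf (p j).2 : ℚ) : ℝ)

/-- `X ⊆ ℝⁿ` is r.e. open. -/
def IsREOpen {n : ℕ} (X : TopologicalSpace.Opens (E n)) : Prop :=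
  IsComputableElem (openRep n) X

/-- `x ∈ ℝⁿ` is computable. -/
def IsComputablePt {n : ℕ} (x : E n) : Prop := IsComputableElem (cauchyRep n) x

/-- `f : D → ℝᵐ`, `D ⊆ ℝⁿ`, is a computable function. -/
def IsComputableFun {n m : ℕ} (D : Set (E n)) (f : E n → E m) : Prop :=
  ComputableOn (cauchyRep n) (cauchyRep m) D f

/-! ### Derivatives and local right inverses -/

/-- The Jacobian matrix of `f` at `x`. -/
noncomputable def jacobian {n m : ℕ} (f : E n → E m) (x : E n) : Matrix (Fin m) (Fin n) ℝ :=
  Matrix.of fun i j => (fderiv ℝ f x (EuclideanSpace.single j 1)) i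

/-- An `m × n` matrix as a vector with `m * n` entries. -/
noncomputable def matVec {n m : ℕ} (A : Matrix (Fin m) (Fin n) ℝ) : E (m * n) :=
  WithLp.toLp 2 fun k => A (finProdFinEquiv.symm k).1 (finProdFinEquiv.symm k).2

/-- `f` is differentiable on the open set `D`, and `f' : D → ℝ^{m × n}` is computable. -/
def HasComputableDeriv {n m : ℕ} (D : Set (E n)) (f : E n → E m) : Prop :=
  DifferentiableOn ℝ f D ∧ IsComputableFun D (fun x => matVec (jacobian f x))

/-- On the ball `B(f(x₀), δ)`, `g` is a `C¹` function with values in `U`, `g(f(x₀)) = x₀`, and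
`f(g(y)) = y` for all `y` in that ball. -/
def IsLocalRightInverse {n m : ℕ} (f : E n → E m) (U : Set (E n)) (x₀ : E n) (δ : ℝ)
    (g : E m → E n) : Prop :=
  ContDiffOn ℝ 1 g (Metric.ball (f x₀) δ) ∧ Set.MapsTo g (Metric.ball (f x₀) δ) U ∧
    g (f x₀) = x₀ ∧ ∀ y ∈ Metric.ball (f x₀) δ, f (g y) = y

/-- The multi-valued mapping `I : (U, x₀) ⇉ k` belonging to `f : X → ℝᵐ`. -/
def radiusRel {n m : ℕ} (X : TopologicalSpace.Opens (E n)) (f : E n → E m)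
    (a : TopologicalSpace.Opens (E n) × E n) (k : ℕ) : Prop :=
  a.2 ∈ a.1 ∧ a.1 ≤ X ∧ (jacobian f a.2).rank = m ∧
    ∃ g : E m → E n, IsLocalRightInverse f a.1 a.2 ((2 : ℝ)⁻¹ ^ k) g

end TTE

/-! A right inverse of the matrix `f' x₀` exists by the rank condition, and by density it can be
replaced by a rational matrix `C` with `f' x₀ * C` within 1/2 of the identity. Put `F z = f (x₀ + C
z)`, a map between open parts of `ℝᵐ`. Where `F'` stays within 1/2 of the identity, on a ball of
radius `r` about 0, `F` satisfies `‖z - z'‖ ≤ 2 ‖F z - F z'‖` and its image contains the ball of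
radius `r / 2` about `f x₀`. With `G` the inverse of `F`, the right inverse is `g y = x₀ + C (G y)`
(`exists_inverse_of_near_id`, `exists_local_inverse`).

All algorithms are unbounded searches for finite certificates (`exists_search`). For `g y`, search
for a rational `z` with `F z` visibly close to `y`; the expansion estimate bounds the error
(`isComputableFun_inverse`). For `g' y = C * N` with `N` the inverse of `f' (g y) * C`, search for a
rational `N` with small residual `f' (g y) * C * N - 1` (`isComputableFun_jacobian_inverse`).

For the radius, the point is that an output written after a finite prefix is correct for every point
sharing that prefix (`Computes.sound`). A single approximation of `f'` therefore bounds `f' * C - 1`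
on a whole neighbourhood of `x₀`, and no modulus of continuity is needed (`RadiusEvidence.sound`,
`RadiusEvidence.complete`). -/

namespace TTE

/-! ### Semidecidable predicates and their closure properties -/

section Semidecidable

variable {σ τ α β γ : Type} [Primcodable σ] [Primcodable τ] [Primcodable α] [Primcodable β]
  [Primcodable γ]

theorem computable_pi {n : ℕ} {f : σ → Fin n → β} (h : ∀ i, Computable fun s => f s i) :
    Computable f :=
  ((Primrec.vector_get' (α := β) (n := n)).to_comp.comp
    (Computable.vector_ofFn (f := fun i s => f s i) h)).of_eq fun s => by
      funext i; simp

theorem computable_apply {n : ℕ} {f : σ → Fin n → β} (h : Computable f) (i : Fin n) :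
    Computable fun s => f s i :=
  Computable.fin_app.comp h (Computable.const i)

theorem computable_pre {f : σ → ℕ → β} (hf : Computable₂ f) :
    Computable₂ fun s k => pre (f s) k := by
  let step : σ × ℕ → ℕ × List β → List β := fun x y => y.2 ++ [f x.1 y.1]
  have hs : Computable₂ step :=
    Computable.list_concat.comp (Computable.snd.comp Computable.snd)
      (hf.comp (Computable.fst.comp Computable.fst) (Computable.fst.comp Computable.snd))
  refine (Computable.nat_rec (h := step) Computable.snd (Computable.const []) hs).of_eq ?_
  rintro ⟨s, k⟩
  induction k with
  | zero => rfl
  | succ k ih =>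
    simp only [pre, List.range_succ, List.map_append, List.map_cons, List.map_nil] at ih ⊢
    rw [ih]

/-- A predicate is semidecidable if it is the projection of a decidable predicate. -/
def SemiDec (T : σ → Prop) : Prop :=
  ∃ c : σ → ℕ → Bool, Computable₂ c ∧ ∀ s, T s ↔ ∃ k, c s k = true

namespace SemiDec

theorem of_iff {T T' : σ → Prop} (h : SemiDec T) (e : ∀ s, T' s ↔ T s) : SemiDec T' := by
  obtain ⟨c, hc, hT⟩ := h
  exact ⟨c, hc, fun s => (e s).trans (hT s)⟩

theorem of_decide {T : σ → Prop} {c : σ → Bool} (hc : Computable c) (h : ∀ s, T s ↔ c s = true) :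
    SemiDec T :=
  ⟨fun s _ => c s, (hc.comp Computable.fst).to₂, fun s => by simp [h]⟩

theorem and {T T' : σ → Prop} (h : SemiDec T) (h' : SemiDec T') :
    SemiDec fun s => T s ∧ T' s := by
  obtain ⟨c, hc, hT⟩ := h
  obtain ⟨c', hc', hT'⟩ := h'
  refine ⟨fun s k => c s k.unpair.1 && c' s k.unpair.2, ?_, fun s => ?_⟩
  · have hu : Computable fun x : σ × ℕ => x.2.unpair := Computable.unpair.comp Computable.snd
    exact Primrec.and.to_comp.comp
      (hc.comp Computable.fst (Computable.fst.comp hu))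
      (hc'.comp Computable.fst (Computable.snd.comp hu))
  · simp only [hT, hT']
    constructor
    · rintro ⟨⟨k, hk⟩, k', hk'⟩
      exact ⟨Nat.pair k k', by simp [hk, hk']⟩
    · rintro ⟨k, hk⟩
      rw [Bool.and_eq_true] at hk
      exact ⟨⟨_, hk.1⟩, _, hk.2⟩

/-- Dovetailing: one number codes both a candidate witness and a stage of its verification. -/
theorem ex {R : σ → τ → Prop} (h : SemiDec fun x : σ × τ => R x.1 x.2) :
    SemiDec fun s => ∃ t, R s t := by
  obtain ⟨c, hc, hT⟩ := h
  refine ⟨fun s k => ((Encodable.decode (α := τ) k.unpair.1).map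
    fun t => c (s, t) k.unpair.2).getD false, ?_, fun s => ?_⟩
  · have hu : Computable fun x : σ × ℕ => x.2.unpair := Computable.unpair.comp Computable.snd
    refine Computable.option_getD (Computable.option_map
      (Computable.decode.comp (Computable.fst.comp hu)) ?_) (Computable.const false)
    exact hc.comp ((Computable.fst.comp Computable.fst).pair Computable.snd)
      (Computable.snd.comp (hu.comp Computable.fst))
  · constructor
    · rintro ⟨t, ht⟩
      obtain ⟨k, hk⟩ := (hT (s, t)).1 ht
      exact ⟨Nat.pair (Encodable.encode t) k, by simp [hk]⟩
    · rintro ⟨k, hk⟩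
      cases hd : (Encodable.decode (α := τ) k.unpair.1) with
      | none => simp [hd] at hk
      | some t => exact ⟨t, (hT (s, t)).2 ⟨k.unpair.2, by simpa [hd] using hk⟩⟩

theorem eq {f g : σ → β} (hf : Computable f) (hg : Computable g) :
    SemiDec fun s => f s = g s := by
  classical
  exact of_decide (c := fun s => f s == g s) (Primrec.beq.to_comp.comp hf hg) fun s => by simp

end SemiDec

end Semidecidable

/-! ### Unbounded search by a Type-2 machine -/

section Search

variable {σ α β : Type}

theorem pre_length (p : ℕ → α) (k : ℕ) : (pre p k).length = k := by simp [pre]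

theorem pre_take (p : ℕ → α) {s k : ℕ} (h : s ≤ k) : (pre p k).take s = pre p s := by
  simp [pre, ← List.map_take, List.take_range, h]

theorem pre_prefix (p : ℕ → α) {s k : ℕ} (h : s ≤ k) : pre p s <+: pre p k := by
  rw [← pre_take p h]; exact List.take_prefix _ _

theorem pre_getElem?_eq_some {p : ℕ → α} {k i : ℕ} {a : α} :
    (pre p k)[i]? = some a ↔ i < k ∧ p i = a := by
  simp only [pre, List.getElem?_map, Option.map_eq_some_iff]
  by_cases h : i < k <;> simp [h]

/-- The first `some` among the values of a function at `0, …, k - 1`. -/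
def firstSome (f : ℕ → Option β) : ℕ → Option β
  | 0 => none
  | k + 1 => (firstSome f k).or (f k)

theorem firstSome_spec {f : ℕ → Option β} {k : ℕ} {b : β} (h : firstSome f k = some b) :
    ∃ t < k, f t = some b := by
  induction k with
  | zero => simp [firstSome] at h
  | succ k ih =>
    rw [firstSome, Option.or_eq_some_iff] at h
    rcases h with h | h
    · obtain ⟨t, ht, e⟩ := ih h
      exact ⟨t, by omega, e⟩
    · exact ⟨k, by omega, h.2⟩

theorem firstSome_mono {f g : ℕ → Option β} {k l : ℕ} {b : β} (hkl : k ≤ l)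
    (hfg : ∀ t < k, f t = g t) (h : firstSome f k = some b) : firstSome g l = some b := by
  have e : firstSome f k = firstSome g k := by
    clear h hkl
    induction k with
    | zero => rfl
    | succ k ih => rw [firstSome, firstSome, ih fun t ht => hfg t (by omega), hfg k (by omega)]
  rw [e] at h
  induction l, hkl using Nat.le_induction with
  | base => exact h
  | succ l _ ih => simp [firstSome, ih]

theorem firstSome_isSome {f : ℕ → Option β} {k t : ℕ} (ht : t < k) (h : (f t).isSome) :
    (firstSome f k).isSome := by
  induction k with
  | zero => omega
  | succ k ih =>
    rw [firstSome, Option.isSome_or]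
    rcases Nat.lt_succ_iff_lt_or_eq.1 ht with h' | rfl
    · simp [ih h']
    · simp [h]

variable [Primcodable σ] [Primcodable α] [Primcodable β]

theorem computable_firstSome {f : σ → ℕ → Option β} (hf : Computable₂ f) :
    Computable₂ fun s k => firstSome (f s) k := by
  let step : σ × ℕ → ℕ × Option β → Option β := fun x y => y.2.or (f x.1 y.1)
  have hs : Computable₂ step := by
    refine (Primrec.option_orElse.to_comp.comp (Computable.snd.comp Computable.snd)
      (hf.comp (Computable.fst.comp Computable.fst)
        (Computable.fst.comp Computable.snd))).of_eq fun x => ?_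
    rcases x with ⟨x, y, _ | b⟩ <;> rfl
  refine (Computable.nat_rec (h := step) Computable.snd (Computable.const none) hs).of_eq ?_
  rintro ⟨s, k⟩
  induction k with
  | zero => rfl
  | succ k ih => simp only [firstSome] at ih ⊢; rw [ih]

/-- A Type-2 machine can search, for each `i`, for a symbol `b` such that a semidecidable relation
holds between some finite prefix of the input, `i` and `b`. -/
theorem exists_search {T : List α → ℕ → β → Prop}
    (hT : SemiDec fun x : List α × ℕ × β => T x.1 x.2.1 x.2.2) :
    ∃ h : List α → ℕ → Option β, Computable₂ h ∧ IsMonotoneWord h ∧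
      ∀ p : ℕ → α, (∀ i, ∃ s b, T (pre p s) i b) →
        ∃ q, Produces h p q ∧ ∀ i, ∃ s, T (pre p s) i (q i) := by
  obtain ⟨c, hc, hcT⟩ := hT
  -- The number `t` codes a prefix length, a candidate symbol and a stage. The prefix length is at
  -- most `t`, and only `t < w.length` is tried on the word `w`, so extending `w` changes none of
  -- the earlier tests. This makes the search monotone.
  let test : List α × ℕ → ℕ → Option β := fun x t =>
    (Encodable.decode (α := β) t.unpair.2.unpair.1).bind fun b =>
      bif c (x.1.take t.unpair.1, x.2, b) t.unpair.2.unpair.2 then some b else none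
  have htest : Computable₂ test := by
    have hu : Computable fun x : (List α × ℕ) × ℕ => x.2.unpair :=
      Computable.unpair.comp Computable.snd
    have hu2 : Computable fun x : (List α × ℕ) × ℕ => x.2.unpair.2.unpair :=
      Computable.unpair.comp (Computable.snd.comp hu)
    refine Computable.option_bind (Computable.decode.comp (Computable.fst.comp hu2)) ?_
    refine Computable.cond (hc.comp ?_ (Computable.snd.comp (hu2.comp Computable.fst)))
      (Computable.option_some.comp Computable.snd) (Computable.const none)
    exact (Primrec.list_take.to_comp.comp (Computable.fst.comp (hu.comp Computable.fst))
      (Computable.fst.comp (Computable.fst.comp Computable.fst))).pair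
      ((Computable.snd.comp (Computable.fst.comp Computable.fst)).pair Computable.snd)
  have htest_spec : ∀ w i t b, test (w, i) t = some b → T (w.take t.unpair.1) i b := by
    intro w i t b h
    simp only [test, Option.bind_eq_some_iff] at h
    obtain ⟨b', -, h⟩ := h
    cases hcc : c (List.take (Nat.unpair t).1 w, i, b') (Nat.unpair (Nat.unpair t).2).2 with
    | false => simp [hcc] at h
    | true =>
      simp only [hcc, cond_true, Option.some.injEq] at h
      subst h
      exact (hcT _).2 ⟨_, hcc⟩
  refine ⟨fun w i => firstSome (test (w, i)) w.length, ?_, ?_, ?_⟩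
  · exact (computable_firstSome htest).comp Computable.id
      (Computable.list_length.comp Computable.fst)
  · intro w w' i b hw h
    refine firstSome_mono hw.length_le (fun t ht => ?_) h
    have : t.unpair.1 ≤ w.length := (Nat.unpair_left_le t).trans ht.le
    have e : w.take t.unpair.1 = w'.take t.unpair.1 := by
      obtain ⟨u, rfl⟩ := hw
      rw [List.take_append_of_le_length this]
    simp only [test, e]
  · intro p hp
    have key : ∀ i, ∃ k b, firstSome (test (pre p k, i)) (pre p k).length = some b := by
      intro i
      obtain ⟨s, b, hb⟩ := hp i
      obtain ⟨m, hm⟩ := (hcT (pre p s, i, b)).1 hb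
      let t := Nat.pair s (Nat.pair (Encodable.encode b) m)
      have hst : s ≤ t + 1 := (Nat.left_le_pair _ _).trans (Nat.le_succ _)
      refine ⟨t + 1, Option.isSome_iff_exists.1 (firstSome_isSome (t := t) (by simp [pre]) ?_)⟩
      simp only [test, t, Nat.unpair_pair, Encodable.encodek, Option.bind_some]
      rw [pre_take p hst, hm]
      rfl
    choose k q hkq using key
    refine ⟨q, fun i => ⟨k i, hkq i⟩, fun i => ?_⟩
    obtain ⟨t, ht, h⟩ := firstSome_spec (hkq i)
    refine ⟨t.unpair.1, ?_⟩
    have := htest_spec _ _ _ _ h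
    rwa [pre_take] at this
    exact (Nat.unpair_left_le t).trans (by simpa [pre] using ht.le)

end Search

/-! ### Computable arithmetic on codes of rationals -/

section Rational

variable {σ τ : Type} [Primcodable σ] [Primcodable τ]

/-- A rational-valued function on a countable type that is computable with respect to the
notation `ratOf`. -/
def RatComputable (φ : σ → ℚ) : Prop :=
  ∃ c : σ → RatCode, Computable c ∧ ∀ s, ratOf (c s) = φ s

theorem exists_ratOf_eq (q : ℚ) : ∃ c, ratOf c = q := by
  refine ⟨(q.num.toNat, (-q.num).toNat, q.den - 1), ?_⟩
  have h1 : ((q.num.toNat : ℚ) - ((-q.num).toNat : ℚ)) = q.num := by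
    exact_mod_cast Int.toNat_sub_toNat_neg q.num
  have h2 : ((q.den - 1 : ℕ) : ℚ) + 1 = q.den := by
    rw [Nat.cast_sub q.den_pos]; simp
  simp only [ratOf, h1, h2, Rat.num_div_den]

namespace RatComputable

theorem const (q : ℚ) : RatComputable fun _ : σ => q := by
  obtain ⟨c, hc⟩ := exists_ratOf_eq q
  exact ⟨fun _ => c, Computable.const _, fun _ => hc⟩

theorem of_code {c : σ → RatCode} (hc : Computable c) : RatComputable fun s => ratOf (c s) :=
  ⟨c, hc, fun _ => rfl⟩

theorem congr {φ ψ : σ → ℚ} (h : RatComputable φ) (e : ∀ s, φ s = ψ s) : RatComputable ψ := by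
  rwa [← funext e]

theorem add {φ ψ : σ → ℚ} (h : RatComputable φ) (h' : RatComputable ψ) :
    RatComputable fun s => φ s + ψ s := by
  obtain ⟨c, hc, e⟩ := h
  obtain ⟨d, hd, e'⟩ := h'
  -- Codes store the denominator minus one, and `(c + 1) * (d + 1) - 1 = c * d + c + d`.
  have hop : Primrec₂ fun (x y : RatCode) => ((x.1 * (y.2.2 + 1) + y.1 * (x.2.2 + 1),
      x.2.1 * (y.2.2 + 1) + y.2.1 * (x.2.2 + 1), x.2.2 * y.2.2 + x.2.2 + y.2.2) : RatCode) := by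
    have a1 : Primrec fun z : RatCode × RatCode => z.1.1 := Primrec.fst.comp Primrec.fst
    have a2 : Primrec fun z : RatCode × RatCode => z.1.2.1 :=
      Primrec.fst.comp (Primrec.snd.comp Primrec.fst)
    have a3 : Primrec fun z : RatCode × RatCode => z.1.2.2 :=
      Primrec.snd.comp (Primrec.snd.comp Primrec.fst)
    have b1 : Primrec fun z : RatCode × RatCode => z.2.1 := Primrec.fst.comp Primrec.snd
    have b2 : Primrec fun z : RatCode × RatCode => z.2.2.1 :=
      Primrec.fst.comp (Primrec.snd.comp Primrec.snd)
    have b3 : Primrec fun z : RatCode × RatCode => z.2.2.2 :=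
      Primrec.snd.comp (Primrec.snd.comp Primrec.snd)
    exact (Primrec.nat_add.comp (Primrec.nat_mul.comp a1 (Primrec.succ.comp b3))
      (Primrec.nat_mul.comp b1 (Primrec.succ.comp a3))).pair
      ((Primrec.nat_add.comp (Primrec.nat_mul.comp a2 (Primrec.succ.comp b3))
      (Primrec.nat_mul.comp b2 (Primrec.succ.comp a3))).pair
      (Primrec.nat_add.comp (Primrec.nat_add.comp (Primrec.nat_mul.comp a3 b3) a3) b3))
  refine ⟨_, hop.to_comp.comp hc hd, fun s => ?_⟩
  simp only [← e, ← e']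
  simp only [ratOf]
  push_cast
  have h1 : ((c s).2.2 : ℚ) + 1 ≠ 0 := by positivity
  have h2 : ((d s).2.2 : ℚ) + 1 ≠ 0 := by positivity
  rw [div_add_div _ _ h1 h2]
  congr 1 <;> ring

theorem mul {φ ψ : σ → ℚ} (h : RatComputable φ) (h' : RatComputable ψ) :
    RatComputable fun s => φ s * ψ s := by
  obtain ⟨c, hc, e⟩ := h
  obtain ⟨d, hd, e'⟩ := h'
  have hop : Primrec₂ fun (x y : RatCode) => ((x.1 * y.1 + x.2.1 * y.2.1,
      x.1 * y.2.1 + x.2.1 * y.1, x.2.2 * y.2.2 + x.2.2 + y.2.2) : RatCode) := by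
    have a1 : Primrec fun z : RatCode × RatCode => z.1.1 := Primrec.fst.comp Primrec.fst
    have a2 : Primrec fun z : RatCode × RatCode => z.1.2.1 :=
      Primrec.fst.comp (Primrec.snd.comp Primrec.fst)
    have a3 : Primrec fun z : RatCode × RatCode => z.1.2.2 :=
      Primrec.snd.comp (Primrec.snd.comp Primrec.fst)
    have b1 : Primrec fun z : RatCode × RatCode => z.2.1 := Primrec.fst.comp Primrec.snd
    have b2 : Primrec fun z : RatCode × RatCode => z.2.2.1 :=
      Primrec.fst.comp (Primrec.snd.comp Primrec.snd)
    have b3 : Primrec fun z : RatCode × RatCode => z.2.2.2 :=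
      Primrec.snd.comp (Primrec.snd.comp Primrec.snd)
    exact (Primrec.nat_add.comp (Primrec.nat_mul.comp a1 b1) (Primrec.nat_mul.comp a2 b2)).pair
      ((Primrec.nat_add.comp (Primrec.nat_mul.comp a1 b2) (Primrec.nat_mul.comp a2 b1)).pair
      (Primrec.nat_add.comp (Primrec.nat_add.comp (Primrec.nat_mul.comp a3 b3) a3) b3))
  refine ⟨_, hop.to_comp.comp hc hd, fun s => ?_⟩
  simp only [← e, ← e']
  simp only [ratOf]
  push_cast
  rw [div_mul_div_comm]
  congr 1 <;> ring

theorem sub {φ ψ : σ → ℚ} (h : RatComputable φ) (h' : RatComputable ψ) :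
    RatComputable fun s => φ s - ψ s :=
  (h.add ((const (-1)).mul h')).congr fun s => by ring

theorem abs {φ : σ → ℚ} (h : RatComputable φ) : RatComputable fun s => |φ s| := by
  obtain ⟨c, hc, e⟩ := h
  -- Subtraction is truncated, so one of the two summands vanishes and the other is the absolute
  -- difference.
  have hop : Primrec fun (x : RatCode) =>
      (((x.1 - x.2.1) + (x.2.1 - x.1), 0, x.2.2) : RatCode) := by
    have a1 : Primrec fun z : RatCode => z.1 := Primrec.fst
    have a2 : Primrec fun z : RatCode => z.2.1 := Primrec.fst.comp Primrec.snd
    have a3 : Primrec fun z : RatCode => z.2.2 := Primrec.snd.comp Primrec.snd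
    exact (Primrec.nat_add.comp (Primrec.nat_sub.comp a1 a2) (Primrec.nat_sub.comp a2 a1)).pair
      ((Primrec.const 0).pair a3)
  refine ⟨_, hop.to_comp.comp hc, fun s => ?_⟩
  simp only [← e]
  have h1 : (0 : ℚ) < ((c s).2.2 : ℚ) + 1 := by positivity
  simp only [ratOf, abs_div, abs_of_pos h1]
  congr 1
  rcases le_total (c s).1 (c s).2.1 with h | h
  · rw [Nat.sub_eq_zero_of_le h, abs_of_nonpos (by simpa using h)]
    push_cast [Nat.cast_sub h]
    ring
  · rw [Nat.sub_eq_zero_of_le h, abs_of_nonneg (by simpa using h)]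
    push_cast [Nat.cast_sub h]
    ring

theorem sum : ∀ {n : ℕ} {φ : Fin n → σ → ℚ}, (∀ i, RatComputable (φ i)) →
    RatComputable fun s => ∑ i, φ i s
  | 0, _, _ => (const 0).congr fun s => by simp
  | n + 1, φ, h => ((h 0).add (sum fun i => h i.succ)).congr fun s => by
      rw [Fin.sum_univ_succ]

theorem two_inv_pow {f : σ → ℕ} (hf : Computable f) :
    RatComputable fun s => (2 : ℚ)⁻¹ ^ f s := by
  have hop : Primrec fun k : ℕ => ((1, 0, 2 ^ k - 1) : RatCode) :=
    (Primrec.const 1).pair ((Primrec.const 0).pair (Primrec.nat_sub.comp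
      ((Primrec₂.unpaired'.1 Nat.Primrec.pow).comp (Primrec.const 2) Primrec.id)
      (Primrec.const 1)))
  refine ⟨_, hop.to_comp.comp hf, fun s => ?_⟩
  simp [ratOf, Nat.cast_sub (Nat.one_le_two_pow)]

theorem semiDec_lt {φ ψ : σ → ℚ} (h : RatComputable φ) (h' : RatComputable ψ) :
    SemiDec fun s => φ s < ψ s := by
  obtain ⟨c, hc, e⟩ := h.sub h'
  have hop : Primrec fun x : RatCode => decide (x.1 < x.2.1) :=
    (PrimrecRel.comp Primrec.nat_lt Primrec.fst (Primrec.fst.comp Primrec.snd)).decide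
  refine SemiDec.of_decide (hop.to_comp.comp hc) fun s => ?_
  have h1 : (0 : ℚ) < ((c s).2.2 : ℚ) + 1 := by positivity
  rw [← sub_neg, show φ s - ψ s = _ from (e s).symm, ratOf, div_neg_iff]
  simp [h1, h1.le.not_gt]

theorem exists_vec {n : ℕ} {φ : Fin n → σ → ℚ} (h : ∀ i, RatComputable (φ i)) :
    ∃ c : σ → Fin n → RatCode, Computable c ∧ ∀ s i, ratOf (c s i) = φ i s := by
  choose c hc e using h
  exact ⟨fun s i => c i s, computable_pi hc, fun s i => e i s⟩

end RatComputable

end Rational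

/-! ### Finite prefixes of names and continuity of computable functions -/

section Names

variable {n m : ℕ}

theorem denseRange_vecOf (n : ℕ) : DenseRange (vecOf (n := n)) := by
  rw [Metric.denseRange_iff]
  intro x r hr
  have hd : DenseRange (fun q : Fin n → ℚ => fun i => (q i : ℝ)) :=
    DenseRange.piMap fun _ => Rat.denseRange_cast
  have ho : IsOpen ((fun y : Fin n → ℝ => (WithLp.toLp 2 y : E n)) ⁻¹' Metric.ball x r) :=
    Metric.isOpen_ball.preimage (PiLp.continuous_toLp 2 _)
  obtain ⟨q, hq⟩ := hd.exists_mem_open ho ⟨WithLp.ofLp x, by simpa using hr⟩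
  choose c hc using fun i => exists_ratOf_eq (q i)
  refine ⟨c, ?_⟩
  have : vecOf c = WithLp.toLp 2 fun i => (q i : ℝ) := by simp [vecOf, hc]
  rw [this, dist_comm]
  exact hq

theorem exists_vecOf_near (x : E n) {ε : ℝ} (hε : 0 < ε) : ∃ c, ‖x - vecOf c‖ < ε := by
  obtain ⟨c, hc⟩ := Metric.denseRange_iff.1 (denseRange_vecOf n) x ε hε
  exact ⟨c, by rwa [← dist_eq_norm]⟩

/-- `w` is a prefix of a name of `x`. -/
def IsNamePrefix (w : List (Fin n → RatCode)) (x : E n) : Prop :=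
  ∀ j c, w[j]? = some c → ‖x - vecOf c‖ < (2 : ℝ)⁻¹ ^ j

theorem IsNamePrefix.exists_name {w : List (Fin n → RatCode)} {x : E n} (h : IsNamePrefix w x) :
    ∃ p, cauchyRep n p x ∧ pre p w.length = w := by
  choose a ha using fun j : ℕ => exists_vecOf_near x (ε := (2 : ℝ)⁻¹ ^ j) (by positivity)
  refine ⟨fun j => w[j]?.getD (a j), fun j => ?_, ?_⟩
  · cases e : w[j]? with
    | none => simpa [e] using ha j
    | some c => simpa [e] using h j c e
  · refine List.ext_getElem (by simp [pre]) fun i h1 h2 => ?_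
    simp [pre, h2]

theorem isNamePrefix_pre {p : ℕ → Fin n → RatCode} {x : E n} (h : cauchyRep n p x) (k : ℕ) :
    IsNamePrefix (pre p k) x := by
  intro j c hc
  obtain ⟨-, rfl⟩ := pre_getElem?_eq_some.1 hc
  exact h j

/-- Dropping the first entry leaves a name with twice the required precision. The spare half `2⁻¹ ^
(j + 1)` absorbs the move from `x` to `x'`, so one word serves a whole neighbourhood of `x`. -/
theorem isNamePrefix_shift {p : ℕ → Fin n → RatCode} {x x' : E n} (hp : cauchyRep n p x) {k : ℕ}
    (hx : ‖x' - x‖ ≤ (2 : ℝ)⁻¹ ^ k) : IsNamePrefix (pre (fun j => p (j + 1)) k) x' := by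
  intro j c hc
  obtain ⟨hj, rfl⟩ := pre_getElem?_eq_some.1 hc
  have h1 : (2 : ℝ)⁻¹ ^ k ≤ 2⁻¹ ^ (j + 1) :=
    pow_le_pow_of_le_one (by norm_num) (by norm_num) hj
  have h2 := hp (j + 1)
  calc ‖x' - vecOf (p (j + 1))‖ ≤ ‖x' - x‖ + ‖x - vecOf (p (j + 1))‖ :=
        norm_sub_le_norm_sub_add_norm_sub _ _ _
    _ < 2⁻¹ ^ (j + 1) + 2⁻¹ ^ (j + 1) := by linarith
    _ = 2⁻¹ ^ j := by rw [pow_succ]; ring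

theorem cauchyRep_shift {p : ℕ → Fin n → RatCode} {x : E n} (hp : cauchyRep n p x) :
    cauchyRep n (fun j => p (j + 1)) x := fun j =>
  (hp (j + 1)).trans_le (pow_le_pow_of_le_one (by norm_num) (by norm_num) (Nat.le_succ j))

theorem exists_cauchyRep (x : E n) : ∃ p, cauchyRep n p x := by
  choose a ha using fun j : ℕ => exists_vecOf_near x (ε := (2 : ℝ)⁻¹ ^ j) (by positivity)
  exact ⟨a, ha⟩

theorem exists_two_inv_pow_lt {ε : ℝ} (hε : 0 < ε) : ∃ k, (2 : ℝ)⁻¹ ^ k < ε :=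
  exists_pow_lt_of_lt_one hε (by norm_num)

/-- `h` computes `f` on `D`. -/
def Computes (h : List (Fin n → RatCode) → ℕ → Option (Fin m → RatCode)) (D : Set (E n))
    (f : E n → E m) : Prop :=
  IsMonotoneWord h ∧ ∀ p x, cauchyRep n p x → x ∈ D →
    ∃ q, Produces h p q ∧ cauchyRep m q (f x)

theorem isComputableFun_iff {D : Set (E n)} {f : E n → E m} :
    IsComputableFun D f ↔ ∃ h, Computable₂ h ∧ Computes h D f := by
  constructor
  · rintro ⟨h, hc, hm, hh⟩
    refine ⟨h, hc, hm, fun p x hp hx => ?_⟩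
    obtain ⟨q, y, hq, hy, -, rfl⟩ := hh p x hp ⟨f x, hx, rfl⟩
    exact ⟨q, hq, hy⟩
  · rintro ⟨h, hc, hm, hh⟩
    refine ⟨h, hc, hm, fun p x hp hx => ?_⟩
    obtain ⟨-, hx, -⟩ := hx
    obtain ⟨q, hq, hy⟩ := hh p x hp hx
    exact ⟨q, f x, hq, hy, hx, rfl⟩

namespace Computes

variable {h : List (Fin n → RatCode) → ℕ → Option (Fin m → RatCode)} {D : Set (E n)}
  {f : E n → E m}

/-- The word extends to a full name of `x`, on which the machine must produce a name of `f x`; by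
monotonicity the symbol already written is an entry of that name. -/
theorem sound (hf : Computes h D f) {x : E n} (hx : x ∈ D) {w : List (Fin n → RatCode)}
    (hw : IsNamePrefix w x) {i : ℕ} {v : Fin m → RatCode} (hv : h w i = some v) :
    ‖f x - vecOf v‖ < (2 : ℝ)⁻¹ ^ i := by
  obtain ⟨p, hp, hpw⟩ := hw.exists_name
  obtain ⟨q, hq, hy⟩ := hf.2 p x hp hx
  obtain ⟨k, hk⟩ := hq i
  have h1 := hf.1 _ (pre p (max k w.length)) i _ (pre_prefix p (le_max_left _ _)) hk
  have h2 := hf.1 w (pre p (max k w.length)) i v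
    (by conv_lhs => rw [← hpw]
        exact pre_prefix p (le_max_right _ _)) hv
  rw [h1] at h2
  rw [← Option.some.inj h2]
  exact hy i

theorem continuousOn (hf : Computes h D f) : ContinuousOn f D := by
  intro x hx
  rw [Metric.continuousWithinAt_iff]
  intro ε hε
  obtain ⟨i, hi⟩ := exists_two_inv_pow_lt (half_pos hε)
  obtain ⟨p, hp⟩ := exists_cauchyRep x
  obtain ⟨q, hq, -⟩ := hf.2 _ x (cauchyRep_shift hp) hx
  obtain ⟨k, hk⟩ := hq i
  refine ⟨2⁻¹ ^ k, by positivity, fun x' hx' hd => ?_⟩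
  rw [dist_eq_norm] at hd ⊢
  have h1 := hf.sound hx' (isNamePrefix_shift hp hd.le) hk
  have h2 := hf.sound hx (isNamePrefix_shift hp (x' := x) (by simp)) hk
  rw [norm_sub_rev] at h2
  calc ‖f x' - f x‖ ≤ _ := norm_sub_le_norm_sub_add_norm_sub _ (vecOf (q i)) _
    _ < ε := by linarith

end Computes

end Names

/-! ### Matrix norms and a rational test for approximate right inverses -/

section Matrices

variable {a b c : ℕ}

/-- The continuous linear map given by a matrix. -/
noncomputable def matCLM (A : Matrix (Fin a) (Fin b) ℝ) : E b →L[ℝ] E a :=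
  LinearMap.toContinuousLinearMap (Matrix.toEuclideanLin A)

/-- The matrix of a continuous linear map. -/
noncomputable def clmMat (T : E b →L[ℝ] E a) : Matrix (Fin a) (Fin b) ℝ :=
  Matrix.of fun i j => T (EuclideanSpace.single j 1) i

theorem matCLM_apply (A : Matrix (Fin a) (Fin b) ℝ) (x : E b) (i : Fin a) :
    matCLM A x i = ∑ j, A i j * x j := by
  simp [matCLM, Matrix.toLpLin_apply, Matrix.mulVec, dotProduct]

theorem clmMat_matCLM (A : Matrix (Fin a) (Fin b) ℝ) : clmMat (matCLM A) = A := by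
  ext i j
  simp [clmMat, matCLM_apply]

theorem apply_eq_sum (T : E b →L[ℝ] E a) (x : E b) (i : Fin a) :
    T x i = ∑ j, clmMat T i j * x j := by
  conv_lhs => rw [← (EuclideanSpace.basisFun (Fin b) ℝ).sum_repr x]
  simp [clmMat, mul_comm]

theorem clmMat_comp (S : E b →L[ℝ] E a) (T : E c →L[ℝ] E b) :
    clmMat (S.comp T) = clmMat S * clmMat T := by
  ext i k
  simp only [Matrix.mul_apply]
  rw [clmMat, Matrix.of_apply, ContinuousLinearMap.comp_apply, apply_eq_sum]
  rfl

theorem clmMat_sub (S T : E b →L[ℝ] E a) : clmMat (S - T) = clmMat S - clmMat T := by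
  ext i k
  simp [clmMat]

theorem clmMat_id : clmMat (ContinuousLinearMap.id ℝ (E a)) = 1 := by
  ext i k
  simp [clmMat, Matrix.one_apply]

theorem norm_le_sum_abs (x : E a) : ‖x‖ ≤ ∑ i, |x i| := by
  conv_lhs => rw [← (EuclideanSpace.basisFun (Fin a) ℝ).sum_repr x]
  refine (norm_sum_le _ _).trans (Finset.sum_le_sum fun i _ => ?_)
  simp [norm_smul]

theorem abs_apply_le (x : E a) (i : Fin a) : |x i| ≤ ‖x‖ := by
  simpa using PiLp.norm_apply_le x i

/-- The sum of the absolute values of the entries of a matrix. -/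
def entrySum (A : Matrix (Fin a) (Fin b) ℝ) : ℝ := ∑ i, ∑ j, |A i j|

theorem entrySum_nonneg (A : Matrix (Fin a) (Fin b) ℝ) : 0 ≤ entrySum A :=
  Finset.sum_nonneg fun _ _ => Finset.sum_nonneg fun _ _ => abs_nonneg _

theorem continuous_entrySum : Continuous (entrySum (a := a) (b := b)) :=
  continuous_finsetSum _ fun _ _ => continuous_finsetSum _ fun _ _ =>
    (continuous_id.matrix_elem _ _).abs

theorem norm_le_entrySum (T : E b →L[ℝ] E a) : ‖T‖ ≤ entrySum (clmMat T) := by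
  refine T.opNorm_le_bound (entrySum_nonneg _) fun x => ?_
  refine (norm_le_sum_abs _).trans ?_
  rw [entrySum, Finset.sum_mul]
  refine Finset.sum_le_sum fun i _ => ?_
  rw [apply_eq_sum, Finset.sum_mul]
  refine (Finset.abs_sum_le_sum_abs _ _).trans (Finset.sum_le_sum fun j _ => ?_)
  rw [abs_mul]
  exact mul_le_mul_of_nonneg_left (abs_apply_le x j) (abs_nonneg _)

theorem abs_clmMat_le (T : E b →L[ℝ] E a) (i : Fin a) (j : Fin b) : |clmMat T i j| ≤ ‖T‖ := by
  refine (abs_apply_le _ i).trans ((T.le_opNorm _).trans ?_)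
  simp

theorem matVec_sub (A B : Matrix (Fin a) (Fin b) ℝ) : matVec (A - B) = matVec A - matVec B := rfl

theorem norm_matVec_le (T : E b →L[ℝ] E a) : ‖matVec (clmMat T)‖ ≤ (a * b : ℕ) * ‖T‖ := by
  refine (norm_le_sum_abs _).trans ?_
  refine (Finset.sum_le_card_nsmul _ _ ‖T‖ fun k _ => abs_clmMat_le T _ _).trans ?_
  simp

theorem abs_entry_le_norm_matVec (A : Matrix (Fin a) (Fin b) ℝ) (i : Fin a) (j : Fin b) :
    |A i j| ≤ ‖matVec A‖ := by
  simpa only [matVec, Equiv.symm_apply_apply] using abs_apply_le (matVec A) (finProdFinEquiv (i, j))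

/-- An entry of a coded rational matrix. -/
def entry (C : Fin (a * b) → RatCode) (i : Fin a) (j : Fin b) : ℚ :=
  ratOf (C (finProdFinEquiv (i, j)))

/-- The real matrix given by a coded rational matrix. -/
def codeMat (C : Fin (a * b) → RatCode) : Matrix (Fin a) (Fin b) ℝ :=
  Matrix.of fun i j => (entry C i j : ℝ)

theorem matVec_codeMat (C : Fin (a * b) → RatCode) : matVec (codeMat C) = vecOf C := by
  ext k
  simp only [matVec, codeMat, entry, vecOf, Matrix.of_apply, Prod.mk.eta, Equiv.apply_symm_apply]

/-- The sum of the absolute values of the entries of a coded rational matrix. -/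
def codeSum (C : Fin (a * b) → RatCode) : ℚ := ∑ i, ∑ j, |entry C i j|

theorem codeSum_cast (C : Fin (a * b) → RatCode) : (codeSum C : ℝ) = entrySum (codeMat C) := by
  simp [codeSum, entrySum, codeMat]

/-- An upper bound on the sum of the absolute values of the entries of `A * b - 1`, for all `A` at
distance less than `2⁻ⁱ` to `v`. -/
def defect (v : Fin (a * b) → RatCode) (i : ℕ) (C : Fin (b * a) → RatCode) : ℚ :=
  (∑ k, ∑ l, |∑ j, entry v k j * entry C j l - if k = l then 1 else 0|) +
    2⁻¹ ^ i * (a * codeSum C)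

/-- Replacing `A` by its approximation moves an entry of the product by at most `2⁻¹ ^ i` times the
absolute column sum of `C`; summing over the `a` rows gives the factor `a`. -/
theorem abs_entrySum_sub_le (v : Fin (a * b) → RatCode) (i : ℕ) (C : Fin (b * a) → RatCode)
    {A : Matrix (Fin a) (Fin b) ℝ} (hA : ‖matVec A - vecOf v‖ < (2 : ℝ)⁻¹ ^ i) :
    |entrySum (A * codeMat C - 1) - entrySum (codeMat v * codeMat C - 1)| ≤
      2⁻¹ ^ i * (a * codeSum C) := by
  rw [codeSum_cast]
  have hv : ∀ k j, |A k j - codeMat v k j| ≤ (2 : ℝ)⁻¹ ^ i := fun k j => by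
    rw [← matVec_codeMat, ← matVec_sub] at hA
    exact (abs_entry_le_norm_matVec _ k j).trans hA.le
  have key : ∀ k l, abs (|(A * codeMat C - 1 : Matrix _ _ ℝ) k l| -
      |(codeMat v * codeMat C - 1 : Matrix _ _ ℝ) k l|) ≤
      2⁻¹ ^ i * ∑ j, |codeMat C j l| := fun k l => by
    refine (abs_abs_sub_abs_le_abs_sub _ _).trans ?_
    have : (A * codeMat C - 1 : Matrix _ _ ℝ) k l - (codeMat v * codeMat C - 1 : Matrix _ _ ℝ) k l =
        ∑ j, (A k j - codeMat v k j) * codeMat C j l := by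
      simp [Matrix.mul_apply, sub_mul]
    rw [this, Finset.mul_sum]
    refine (Finset.abs_sum_le_sum_abs _ _).trans (Finset.sum_le_sum fun j _ => ?_)
    rw [abs_mul]
    exact mul_le_mul_of_nonneg_right (hv k j) (abs_nonneg _)
  simp only [entrySum, ← Finset.sum_sub_distrib]
  calc _ ≤ ∑ k : Fin a, ∑ l : Fin a, 2⁻¹ ^ i * ∑ j, |codeMat C j l| :=
        (Finset.abs_sum_le_sum_abs _ _).trans (Finset.sum_le_sum fun k _ =>
          (Finset.abs_sum_le_sum_abs _ _).trans (Finset.sum_le_sum fun l _ => key k l))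
    _ = _ := by
      rw [Finset.sum_comm (f := fun i j => |codeMat C i j|)]
      simp only [← Finset.mul_sum, Finset.sum_const, Finset.card_univ, Fintype.card_fin,
        nsmul_eq_mul]

theorem defect_cast (v : Fin (a * b) → RatCode) (i : ℕ) (C : Fin (b * a) → RatCode) :
    (defect v i C : ℝ) = entrySum (codeMat v * codeMat C - 1) + 2⁻¹ ^ i * (a * codeSum C) := by
  simp only [defect, entrySum, codeMat, Matrix.sub_apply, Matrix.mul_apply, Matrix.of_apply,
    Matrix.one_apply]
  push_cast
  simp only [apply_ite (Rat.cast : ℚ → ℝ), Rat.cast_one, Rat.cast_zero]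

theorem entrySum_le_defect (v : Fin (a * b) → RatCode) (i : ℕ) (C : Fin (b * a) → RatCode)
    {A : Matrix (Fin a) (Fin b) ℝ} (hA : ‖matVec A - vecOf v‖ < (2 : ℝ)⁻¹ ^ i) :
    entrySum (A * codeMat C - 1) ≤ defect v i C := by
  have := (abs_le.1 (abs_entrySum_sub_le v i C hA)).2
  rw [defect_cast]
  linarith

theorem defect_le (v : Fin (a * b) → RatCode) (i : ℕ) (C : Fin (b * a) → RatCode)
    {A : Matrix (Fin a) (Fin b) ℝ} (hA : ‖matVec A - vecOf v‖ < (2 : ℝ)⁻¹ ^ i) :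
    (defect v i C : ℝ) ≤ entrySum (A * codeMat C - 1) + 2 * (2⁻¹ ^ i * (a * codeSum C)) := by
  have := (abs_le.1 (abs_entrySum_sub_le v i C hA)).1
  rw [defect_cast]
  linarith

/-- Completeness of the test: the overestimate in `defect` tends to 0 as the precision grows,
uniformly over all admissible approximations `v`. -/
theorem exists_defect_lt {A : Matrix (Fin a) (Fin b) ℝ} {C : Fin (b * a) → RatCode} {ε : ℝ}
    (h : entrySum (A * codeMat C - 1) < ε) :
    ∃ i, ∀ v, ‖matVec A - vecOf v‖ < (2 : ℝ)⁻¹ ^ i → (defect v i C : ℝ) < ε := by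
  have hlim : Filter.Tendsto
      (fun i : ℕ => entrySum (A * codeMat C - 1) + 2 * ((2 : ℝ)⁻¹ ^ i * (a * codeSum C)))
      Filter.atTop (nhds (entrySum (A * codeMat C - 1) + 2 * (0 * (a * codeSum C)))) :=
    ((((tendsto_pow_atTop_nhds_zero_of_lt_one (by norm_num) (by norm_num)).mul_const _).const_mul
      _).const_add _)
  obtain ⟨i, hi⟩ := (hlim.eventually_lt_const (by simpa using h)).exists
  exact ⟨i, fun v hv => (defect_le v i C hv).trans_lt hi⟩

theorem ratComputable_entry {σ : Type} [Primcodable σ] {C : σ → Fin (a * b) → RatCode}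
    (hC : Computable C) (i : Fin a) (j : Fin b) : RatComputable fun s => entry (C s) i j :=
  .of_code (computable_apply hC _)

theorem ratComputable_codeSum {σ : Type} [Primcodable σ] {C : σ → Fin (a * b) → RatCode}
    (hC : Computable C) : RatComputable fun s => codeSum (C s) :=
  .sum fun i => .sum fun j => (ratComputable_entry hC i j).abs

theorem ratComputable_defect {σ : Type} [Primcodable σ] {v : σ → Fin (a * b) → RatCode} {i : σ → ℕ}
    {C : σ → Fin (b * a) → RatCode} (hv : Computable v) (hi : Computable i) (hC : Computable C) :
    RatComputable fun s => defect (v s) (i s) (C s) :=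
  (RatComputable.sum fun k => .sum fun l => ((RatComputable.sum fun j =>
    (ratComputable_entry hv k j).mul (ratComputable_entry hC j l)).sub (.const _)).abs).add
    ((RatComputable.two_inv_pow hi).mul ((RatComputable.const _).mul (ratComputable_codeSum hC)))

/-- If `A * N = 1` for a real matrix `N`, then nearly so for a rational one. -/
theorem exists_codeMat_entrySum_lt {A : Matrix (Fin a) (Fin b) ℝ} {N : Matrix (Fin b) (Fin a) ℝ}
    (h : A * N = 1) {ε : ℝ} (hε : 0 < ε) :
    ∃ C : Fin (b * a) → RatCode, entrySum (A * codeMat C - 1) < ε := by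
  let Φ : E (b * a) → ℝ := fun x =>
    entrySum (A * Matrix.of (fun i j => x (finProdFinEquiv (i, j))) - 1)
  have hΦ : Continuous Φ := by
    refine continuous_entrySum.comp (Continuous.sub (Continuous.matrix_mul continuous_const ?_)
      continuous_const)
    exact continuous_matrix fun i j => by simp only [Matrix.of_apply]; fun_prop
  obtain ⟨C, hC⟩ := (denseRange_vecOf (b * a)).exists_mem_open (hΦ.isOpen_preimage _ isOpen_Iio)
    (s := Φ ⁻¹' Set.Iio ε) ⟨matVec N, by
      have : (Matrix.of fun i j => (matVec N) (finProdFinEquiv (i, j))) = N := by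
        ext i j; simp only [matVec, Matrix.of_apply, Equiv.symm_apply_apply]
      simp [Φ, this, h, entrySum, hε]⟩
  exact ⟨C, hC⟩

theorem exists_right_inverse_of_rank {A : Matrix (Fin a) (Fin b) ℝ} (h : A.rank = a) :
    ∃ N : Matrix (Fin b) (Fin a) ℝ, A * N = 1 := by
  have hs : Function.Surjective A.mulVecLin := by
    rw [← LinearMap.range_eq_top]
    refine Submodule.eq_top_of_finrank_eq ?_
    simpa [Matrix.rank] using h
  obtain ⟨g, hg⟩ := A.mulVecLin.exists_rightInverse_of_surjective (LinearMap.range_eq_top.2 hs)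
  refine ⟨LinearMap.toMatrix' g, ?_⟩
  have := congrArg LinearMap.toMatrix' hg
  rwa [LinearMap.toMatrix'_comp, LinearMap.toMatrix'_id, ← Matrix.toLin'_apply',
    LinearMap.toMatrix'_toLin'] at this

end Matrices

/-! ### A quantitative inverse function theorem near the identity -/

section Analysis

variable {n m : ℕ}

/-- By the mean value inequality on the convex ball, `F - id` is Lipschitz with constant 1/2. This
gives the expansion estimate and injectivity, and the image of a closed ball of radius `ε` about 0
inside the domain contains the closed ball of radius `ε / 2` about `F 0`. -/
theorem exists_inverse_of_near_id {V : Type*} [NormedAddCommGroup V] [NormedSpace ℝ V]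
    [CompleteSpace V] {F : V → V} {F' : V → V →L[ℝ] V} {r : ℝ} (hr : 0 < r)
    (hF : ∀ z ∈ Metric.ball (0 : V) r, HasFDerivAt F (F' z) z)
    (hF' : ContinuousOn F' (Metric.ball 0 r))
    (hn : ∀ z ∈ Metric.ball (0 : V) r, ‖F' z - ContinuousLinearMap.id ℝ V‖ ≤ 1 / 2) :
    (∀ z ∈ Metric.ball (0 : V) r, ∀ z' ∈ Metric.ball (0 : V) r, ‖z - z'‖ ≤ 2 * ‖F z - F z'‖) ∧
    ∃ G : V → V, G (F 0) = 0 ∧ ContDiffOn ℝ 1 G (Metric.ball (F 0) (r / 2)) ∧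
      ∀ y ∈ Metric.ball (F 0) (r / 2), G y ∈ Metric.ball (0 : V) r ∧ F (G y) = y := by
  have h0 : (0 : V) ∈ Metric.ball (0 : V) r := Metric.mem_ball_self hr
  have hA : ApproximatesLinearOn F
      ((ContinuousLinearEquiv.refl ℝ V : V ≃L[ℝ] V) : V →L[ℝ] V) (Metric.ball 0 r) (1 / 2) := by
    intro x hx y hy
    have := (convex_ball (0 : V) r).norm_image_sub_le_of_norm_hasFDerivWithin_le'
      (fun z hz => (hF z hz).hasFDerivWithinAt) hn hy hx
    simpa using this
  have hexp : ∀ z ∈ Metric.ball (0 : V) r, ∀ z' ∈ Metric.ball (0 : V) r,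
      ‖z - z'‖ ≤ 2 * ‖F z - F z'‖ := by
    intro z hz z' hz'
    have h1 := hA z hz z' hz'
    have h2 : ‖z - z'‖ ≤ ‖F z - F z'‖ + ‖F z - F z' - (z - z')‖ := by
      rw [norm_sub_rev (F z - F z')]
      simpa using norm_add_le (F z - F z') ((z - z') - (F z - F z'))
    simp at h1
    linarith
  -- The trivial space is separate because the identity has norm 0 there.
  have hc : Subsingleton V ∨ (1 / 2 : NNReal) <
      ‖((ContinuousLinearEquiv.refl ℝ V).symm : V →L[ℝ] V)‖₊⁻¹ := by
    rcases subsingleton_or_nontrivial V with h | h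
    · exact .inl h
    · right
      have : ‖((ContinuousLinearEquiv.refl ℝ V).symm : V →L[ℝ] V)‖₊ = 1 :=
        NNReal.eq ContinuousLinearMap.norm_id
      rw [this, inv_one]
      exact NNReal.half_lt_self one_ne_zero
  let P := hA.toOpenPartialHomeomorph F _ hc Metric.isOpen_ball
  have hP : ∀ z, P z = F z := fun _ => rfl
  have hsrc : P.source = Metric.ball 0 r := rfl
  have htgt : Metric.ball (F 0) (r / 2) ⊆ P.target := by
    intro y hy
    -- With right-inverse constant 1, a closed ball of radius `2 * dist y (F 0)` covers radius `(1 -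
    -- 1/2) * 2 * dist y (F 0)`, just enough to reach `y`.
    let R : ((ContinuousLinearEquiv.refl ℝ V : V ≃L[ℝ] V) : V →L[ℝ] V).NonlinearRightInverse :=
      ⟨id, 1, fun y => by simp, fun y => rfl⟩
    have hd : dist y (F 0) < r / 2 := hy
    obtain ⟨z, hz, e⟩ := hA.surjOn_closedBall_of_nonlinearRightInverse R (b := 0)
      (ε := 2 * dist y (F 0)) (by positivity)
      (fun z hz => by
        rw [Metric.mem_closedBall] at hz
        rw [Metric.mem_ball]; linarith) (show y ∈ _ by
        rw [Metric.mem_closedBall]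
        simp only [R]
        norm_num
        linarith)
    refine ⟨z, ?_, e⟩
    rw [Metric.mem_closedBall] at hz
    rw [Metric.mem_ball]; linarith
  refine ⟨hexp, P.symm, ?_, ?_, fun y hy => ⟨P.map_target (htgt hy), P.right_inv (htgt hy)⟩⟩
  · exact P.left_inv h0
  · intro y hy
    refine ContDiffAt.contDiffWithinAt ?_
    have hz : P.symm y ∈ Metric.ball (0 : V) r := P.map_target (htgt hy)
    have hu : ‖ContinuousLinearMap.id ℝ V - F' (P.symm y)‖ < 1 := by
      rw [norm_sub_rev]; linarith [hn _ hz]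
    -- The derivative is invertible by the Neumann series.
    let e : V ≃L[ℝ] V := ContinuousLinearEquiv.ofUnit (Units.oneSub _ hu)
    have he : (e : V →L[ℝ] V) = F' (P.symm y) := by
      have : (e : V →L[ℝ] V) = 1 - (ContinuousLinearMap.id ℝ V - F' (P.symm y)) := rfl
      rw [this]
      exact sub_sub_cancel _ _
    refine P.contDiffAt_symm (f₀' := e) (htgt hy) (he ▸ hF _ hz) ?_
    exact contDiffAt_one_iff.2 ⟨F', _, Metric.isOpen_ball.mem_nhds hz, hF', hF⟩

end Analysis

/-! ### Comparing Euclidean distances with rationals -/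

section Distance

variable {n : ℕ} {σ : Type} [Primcodable σ]

/-- The square of the distance of two coded rational vectors. -/
def distSq (c d : Fin n → RatCode) : ℚ :=
  ∑ i, (ratOf (c i) - ratOf (d i)) * (ratOf (c i) - ratOf (d i))

theorem distSq_cast (c d : Fin n → RatCode) : (distSq c d : ℝ) = ‖vecOf c - vecOf d‖ ^ 2 := by
  rw [EuclideanSpace.norm_sq_eq]
  simp [distSq, vecOf, sq]

/-- Squaring removes the root and leaves a comparison of rationals; the sign of `e`, lost in
squaring, is tested separately. -/
theorem norm_vecOf_sub_lt_iff (c d : Fin n → RatCode) (e : ℚ) :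
    ‖vecOf c - vecOf d‖ < e ↔ 0 < e ∧ distSq c d < e * e := by
  have h : (distSq c d < e * e) ↔ ‖vecOf c - vecOf d‖ ^ 2 < (e : ℝ) ^ 2 := by
    rw [← distSq_cast, sq, ← Rat.cast_mul, Rat.cast_lt]
  rw [h]
  constructor
  · intro h1
    exact ⟨by exact_mod_cast (norm_nonneg _).trans_lt h1, by gcongr⟩
  · rintro ⟨h1, h2⟩
    exact lt_of_pow_lt_pow_left₀ 2 (by exact_mod_cast h1.le) h2

theorem semiDec_norm_sub_lt {c d : σ → Fin n → RatCode} {e : σ → ℚ} (hc : Computable c)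
    (hd : Computable d) (he : RatComputable e) :
    SemiDec fun s => ‖vecOf (c s) - vecOf (d s)‖ < e s := by
  refine (((RatComputable.const 0).semiDec_lt he).and
    (RatComputable.semiDec_lt (φ := fun s => distSq (c s) (d s)) (.sum fun i => ?_)
      (he.mul he))).of_iff fun s => norm_vecOf_sub_lt_iff _ _ _
  have h := (RatComputable.of_code (computable_apply hc i)).sub (.of_code (computable_apply hd i))
  exact h.mul h

end Distance

/-! ### Local right inverses through an approximate right inverse of the derivative -/

section LocalInverse

variable {n m : ℕ}

/-- Restricting `f` to the affine slice `x₀ + L z` turns the problem into one for a map from `E m`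
to itself. -/
theorem exists_local_inverse {f : E n → E m} {U : Set (E n)} (hU : IsOpen U)
    (hf : DifferentiableOn ℝ f U) (hc : ContinuousOn (fderiv ℝ f) U) {x₀ : E n}
    {L : E m →L[ℝ] E n} {r : ℝ} (hr : 0 < r)
    (h : ∀ z ∈ Metric.ball (0 : E m) r, x₀ + L z ∈ U ∧
      ‖(fderiv ℝ f (x₀ + L z)).comp L - ContinuousLinearMap.id ℝ (E m)‖ ≤ 1 / 2) :
    (∀ z ∈ Metric.ball (0 : E m) r, ∀ z' ∈ Metric.ball (0 : E m) r,
      ‖z - z'‖ ≤ 2 * ‖f (x₀ + L z) - f (x₀ + L z')‖) ∧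
    ∃ G : E m → E m, G (f x₀) = 0 ∧ ContDiffOn ℝ 1 G (Metric.ball (f x₀) (r / 2)) ∧
      ∀ y ∈ Metric.ball (f x₀) (r / 2), G y ∈ Metric.ball (0 : E m) r ∧ f (x₀ + L (G y)) = y := by
  have key := exists_inverse_of_near_id (F := fun z => f (x₀ + L z))
    (F' := fun z => (fderiv ℝ f (x₀ + L z)).comp L) hr
    (fun z hz => ?_) ?_ fun z hz => (h z hz).2
  · simpa using key
  · have h1 := (hf.differentiableAt (hU.mem_nhds (h z hz).1)).hasFDerivAt
    exact h1.comp z (L.hasFDerivAt.const_add x₀)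
  · refine ContinuousOn.clm_comp (hc.comp (by fun_prop) fun z hz => (h z hz).1) continuousOn_const

theorem isLocalRightInverse_of_inverse {f : E n → E m} {U : Set (E n)} {x₀ : E n}
    {L : E m →L[ℝ] E n} {r δ : ℝ} (hδ : δ ≤ r / 2)
    (h : ∀ z ∈ Metric.ball (0 : E m) r, x₀ + L z ∈ U) {G : E m → E m} (hG₀ : G (f x₀) = 0)
    (hG : ContDiffOn ℝ 1 G (Metric.ball (f x₀) (r / 2)))
    (hGf : ∀ y ∈ Metric.ball (f x₀) (r / 2), G y ∈ Metric.ball (0 : E m) r ∧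
      f (x₀ + L (G y)) = y) :
    IsLocalRightInverse f U x₀ δ fun y => x₀ + L (G y) := by
  have hsub := Metric.ball_subset_ball (x := f x₀) hδ
  refine ⟨?_, fun y hy => h _ (hGf y (hsub hy)).1, by simp [hG₀], fun y hy => (hGf y (hsub hy)).2⟩
  exact contDiffOn_const.add (L.contDiff.comp_contDiffOn (hG.mono hsub))

/-- In finite dimension continuity of an operator-valued map can be checked vector by vector and
coordinate by coordinate. Since computable functions are continuous, a computable Jacobian yields a
continuous derivative. -/
theorem continuousOn_fderiv {f : E n → E m} {D : Set (E n)}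
    (h : ContinuousOn (fun x => matVec (jacobian f x)) D) : ContinuousOn (fderiv ℝ f) D := by
  rw [continuousOn_clm_apply]
  intro y
  refine (PiLp.continuous_toLp 2 _).comp_continuousOn (f := fun x i => fderiv ℝ f x y i) ?_
  refine continuousOn_pi.2 fun i => ?_
  have e : (fun x => fderiv ℝ f x y i) =
      fun x => ∑ j, matVec (jacobian f x) (finProdFinEquiv (i, j)) * y j := by
    funext x
    rw [apply_eq_sum]
    simp only [matVec, Equiv.symm_apply_apply]
    rfl
  rw [e]
  refine continuousOn_finsetSum _ fun j _ => ContinuousOn.mul ?_ continuousOn_const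
  exact (EuclideanSpace.proj (𝕜 := ℝ) (finProdFinEquiv (i, j))).continuous.comp_continuousOn h

/-- The linear map given by a coded rational matrix. -/
noncomputable def codeCLM {a b : ℕ} (C : Fin (a * b) → RatCode) : E b →L[ℝ] E a :=
  matCLM (codeMat C)

theorem norm_codeCLM_le {a b : ℕ} (C : Fin (a * b) → RatCode) : ‖codeCLM C‖ ≤ codeSum C := by
  rw [codeSum_cast]
  simpa [codeCLM, clmMat_matCLM] using norm_le_entrySum (codeCLM C)

theorem norm_comp_codeCLM_sub_id_le (T : E n →L[ℝ] E m) (C : Fin (n * m) → RatCode) :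
    ‖T.comp (codeCLM C) - ContinuousLinearMap.id ℝ (E m)‖ ≤
      entrySum (clmMat T * codeMat C - 1) := by
  refine (norm_le_entrySum _).trans_eq ?_
  rw [clmMat_sub, clmMat_comp, clmMat_id, codeCLM, clmMat_matCLM]

/-- Only the bound 1/2 is required, so a rational approximation of a right inverse suffices; the
strict inequality at `x₀` spreads to a ball by continuity. -/
theorem exists_ball_near_id {f : E n → E m} {U : Set (E n)} (hU : IsOpen U)
    (hc : ContinuousOn (fderiv ℝ f) U) {x₀ : E n} (hx₀ : x₀ ∈ U)
    (hrank : (jacobian f x₀).rank = m) :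
    ∃ (C : Fin (n * m) → RatCode) (r : ℝ), 0 < r ∧ ∀ z ∈ Metric.ball (0 : E m) r,
      x₀ + codeCLM C z ∈ U ∧
      ‖(fderiv ℝ f (x₀ + codeCLM C z)).comp (codeCLM C) - ContinuousLinearMap.id ℝ (E m)‖ ≤
        1 / 2 := by
  obtain ⟨N, hN⟩ := exists_right_inverse_of_rank hrank
  obtain ⟨C, hC⟩ := exists_codeMat_entrySum_lt hN (ε := 1 / 2) (by norm_num)
  have h0 : ‖(fderiv ℝ f x₀).comp (codeCLM C) - ContinuousLinearMap.id ℝ (E m)‖ < 1 / 2 :=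
    (norm_comp_codeCLM_sub_id_le _ _).trans_lt hC
  have hx : ContinuousAt (fun z => x₀ + codeCLM C z) 0 := by fun_prop
  have hx0 : x₀ + codeCLM C 0 = x₀ := by simp
  have h1 : ∀ᶠ z in nhds 0, x₀ + codeCLM C z ∈ U :=
    hx.eventually_mem (by rw [hx0]; exact hU.mem_nhds hx₀)
  have h2 : ContinuousAt (fun z => ‖(fderiv ℝ f (x₀ + codeCLM C z)).comp (codeCLM C) -
      ContinuousLinearMap.id ℝ (E m)‖) 0 := by
    have h3 : ContinuousAt (fderiv ℝ f) (x₀ + codeCLM C 0) := by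
      rw [hx0]; exact hc.continuousAt (hU.mem_nhds hx₀)
    have h4 : ContinuousAt (fun z => fderiv ℝ f (x₀ + codeCLM C z)) 0 :=
      ContinuousAt.comp (f := fun z => x₀ + codeCLM C z) h3 hx
    exact ((h4.clm_comp continuousAt_const).sub continuousAt_const).norm
  have h3 := h2.eventually_lt continuousAt_const (by rw [hx0]; exact h0)
  obtain ⟨r, hr, h⟩ := Metric.eventually_nhds_iff_ball.1 (h1.and h3)
  exact ⟨C, r, hr, fun z hz => ⟨(h z hz).1, (h z hz).2.le⟩⟩

end LocalInverse

/-! ### Computing an admissible radius -/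

section Radius

variable {n m : ℕ}

theorem map_pre {α β : Type} (g : α → β) (p : ℕ → α) (k : ℕ) :
    (pre p k).map g = pre (fun j => g (p j)) k := by
  simp [pre, Function.comp_def]

theorem tail_pre {α : Type} (p : ℕ → α) (k : ℕ) :
    (pre p k).tail = pre (fun j => p (j + 1)) (k - 1) := by
  cases k with
  | zero => rfl
  | succ k => simp [pre, List.range_succ_eq_map, Function.comp_def]

variable {f : E n → E m} {X : TopologicalSpace.Opens (E n)}
  {h' : List (Fin n → RatCode) → ℕ → Option (Fin (m * n) → RatCode)}

/-- The evidence, found in a finite prefix `w` of a name of `(U, x₀)`, for `2⁻ᵏ` being a suitable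
radius. -/
def RadiusEvidence (h' : List (Fin n → RatCode) → ℕ → Option (Fin (m * n) → RatCode))
    (w : List (((Fin n → RatCode) × RatCode) × (Fin n → RatCode))) (k : ℕ) : Prop :=
  ∃ t : (ℕ × (Fin (m * n) → RatCode) × (Fin (n * m) → RatCode)) ×
      (ℕ × ((Fin n → RatCode) × RatCode) × (Fin n → RatCode)) ×
      (ℕ × ((Fin n → RatCode) × RatCode) × (Fin n → RatCode)),
    -- The witness consists of a precision `i`, an output `v` and a matrix `C`, then an entry of the
    -- point's name and a ball from the list for `U`. Taking the tail makes `v` valid at every point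
    -- of `X` within `2⁻¹ ^ w.length` of `x₀`. The norm condition puts that whole neighbourhood into
    -- the listed ball. The last condition makes `C` map the ball of radius `2 * 2⁻¹ ^ k` into the
    -- neighbourhood; the factor 2 pays for the halving of the radius in the image.
    h' (w.map Prod.snd).tail t.1.1 = some t.1.2.1 ∧ defect t.1.2.1 t.1.1 t.1.2.2 < 1 / 2 ∧
    w[t.2.1.1]? = some t.2.1.2 ∧ w[t.2.2.1]? = some t.2.2.2 ∧
    ‖vecOf t.2.1.2.2 - vecOf t.2.2.2.1.1‖ <
      ((ratOf t.2.2.2.1.2 - 2⁻¹ ^ t.2.1.1 - 2⁻¹ ^ w.length : ℚ) : ℝ) ∧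
    2 * codeSum t.1.2.2 * 2⁻¹ ^ k < 2⁻¹ ^ w.length

theorem semiDec_radiusEvidence (hh' : Computable₂ h') :
    SemiDec fun x : List (((Fin n → RatCode) × RatCode) × (Fin n → RatCode)) × ℕ × ℕ =>
      RadiusEvidence h' x.1 x.2.2 := by
  refine SemiDec.ex ?_
  have hw : Computable fun y : (List (((Fin n → RatCode) × RatCode) × (Fin n → RatCode)) × ℕ × ℕ) ×
      ((ℕ × (Fin (m * n) → RatCode) × (Fin (n * m) → RatCode)) ×
      (ℕ × ((Fin n → RatCode) × RatCode) × (Fin n → RatCode)) ×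
      (ℕ × ((Fin n → RatCode) × RatCode) × (Fin n → RatCode))) => y.1.1 :=
    Computable.fst.comp Computable.fst
  have hk := (Computable.snd.comp (Computable.snd.comp Computable.fst) : Computable
    fun y : (List (((Fin n → RatCode) × RatCode) × (Fin n → RatCode)) × ℕ × ℕ) ×
      ((ℕ × (Fin (m * n) → RatCode) × (Fin (n * m) → RatCode)) ×
      (ℕ × ((Fin n → RatCode) × RatCode) × (Fin n → RatCode)) ×
      (ℕ × ((Fin n → RatCode) × RatCode) × (Fin n → RatCode))) => y.1.2.2)
  have ht := (Computable.snd : Computable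
    fun y : (List (((Fin n → RatCode) × RatCode) × (Fin n → RatCode)) × ℕ × ℕ) ×
      ((ℕ × (Fin (m * n) → RatCode) × (Fin (n * m) → RatCode)) ×
      (ℕ × ((Fin n → RatCode) × RatCode) × (Fin n → RatCode)) ×
      (ℕ × ((Fin n → RatCode) × RatCode) × (Fin n → RatCode))) => y.2)
  have h1 := Computable.fst.comp ht
  have h2 := Computable.fst.comp (Computable.snd.comp ht)
  have h3 := Computable.snd.comp (Computable.snd.comp ht)
  have hlen := RatComputable.two_inv_pow (Computable.list_length.comp hw)
  refine .and (.eq (hh'.comp ?_ (Computable.fst.comp h1))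
    (Computable.option_some.comp (Computable.fst.comp (Computable.snd.comp h1)))) <|
    .and (RatComputable.semiDec_lt (ratComputable_defect (Computable.fst.comp (Computable.snd.comp h1))
      (Computable.fst.comp h1) (Computable.snd.comp (Computable.snd.comp h1))) (.const _)) <|
    .and (.eq (Computable.list_getElem?.comp hw (Computable.fst.comp h2))
      (Computable.option_some.comp (Computable.snd.comp h2))) <|
    .and (.eq (Computable.list_getElem?.comp hw (Computable.fst.comp h3))
      (Computable.option_some.comp (Computable.snd.comp h3))) <|
    .and (semiDec_norm_sub_lt (Computable.snd.comp (Computable.snd.comp h2))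
      (Computable.fst.comp (Computable.fst.comp (Computable.snd.comp h3)))
      (((RatComputable.of_code (Computable.snd.comp (Computable.fst.comp
        (Computable.snd.comp h3)))).sub (.two_inv_pow (Computable.fst.comp h2))).sub hlen)) <|
    RatComputable.semiDec_lt (((RatComputable.const 2).mul (ratComputable_codeSum
      (Computable.snd.comp (Computable.snd.comp h1)))).mul (.two_inv_pow hk)) hlen
  have hmap : Primrec fun w : List (((Fin n → RatCode) × RatCode) × (Fin n → RatCode)) =>
      (w.map Prod.snd).tail :=
    Primrec.list_tail.comp (Primrec.list_map Primrec.id (Primrec.snd.comp Primrec.snd).to₂)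
  exact hmap.to_comp.comp hw

theorem RadiusEvidence.sound (hf : DifferentiableOn ℝ f X)
    (hc : Computes h' (X : Set (E n)) fun x => matVec (jacobian f x))
    {U : TopologicalSpace.Opens (E n)} {x₀ : E n} (hUX : U ≤ X)
    {p : ℕ → ((Fin n → RatCode) × RatCode) × (Fin n → RatCode)}
    (hp : prodRep (openRep n) (cauchyRep n) p (U, x₀)) {s k : ℕ}
    (h : RadiusEvidence h' (pre p s) k) :
    ∃ g : E m → E n, IsLocalRightInverse f U x₀ ((2 : ℝ)⁻¹ ^ k) g := by
  obtain ⟨hpU, hpx⟩ := hp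
  obtain ⟨⟨⟨i, v, C⟩, ⟨J, a⟩, ⟨l, zr⟩⟩, h1, h2, h3, h4, h5, h6⟩ := h
  simp only at h1 h2 h3 h4 h5 h6
  obtain ⟨-, rfl⟩ := pre_getElem?_eq_some.1 h3
  obtain ⟨-, rfl⟩ := pre_getElem?_eq_some.1 h4
  rw [map_pre, tail_pre] at h1
  rw [pre_length] at h5 h6
  have hball : ∀ z ∈ Metric.ball (0 : E m) (2 * 2⁻¹ ^ k), ‖codeCLM C z‖ < (2 : ℝ)⁻¹ ^ s := by
    intro z hz
    rw [mem_ball_zero_iff] at hz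
    have h6' : 2 * (codeSum C : ℝ) * 2⁻¹ ^ k < 2⁻¹ ^ s := by
      have := (Rat.cast_lt (K := ℝ)).2 h6
      push_cast at this
      exact this
    have hC := norm_codeCLM_le C
    calc ‖codeCLM C z‖ ≤ ‖codeCLM C‖ * ‖z‖ := (codeCLM C).le_opNorm z
      _ ≤ codeSum C * (2 * 2⁻¹ ^ k) :=
        mul_le_mul hC hz.le (norm_nonneg _) ((norm_nonneg _).trans hC)
      _ < _ := by linarith
  have hmem : ∀ z ∈ Metric.ball (0 : E m) (2 * 2⁻¹ ^ k), x₀ + codeCLM C z ∈ (U : Set (E n)) ∧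
      ‖(fderiv ℝ f (x₀ + codeCLM C z)).comp (codeCLM C) -
        ContinuousLinearMap.id ℝ (E m)‖ ≤ 1 / 2 := by
    intro z hz
    have hz' := hball z hz
    have hU : x₀ + codeCLM C z ∈ (U : Set (E n)) := by
      rw [show (U : Set (E n)) = _ from hpU]
      refine Set.mem_iUnion.2 ⟨l, ?_⟩
      rw [Metric.mem_ball, dist_eq_norm]
      have h7 := hpx J
      push_cast at h5
      calc ‖x₀ + codeCLM C z - vecOf (p l).1.1‖
          = ‖codeCLM C z + (x₀ - vecOf (p J).2) + (vecOf (p J).2 - vecOf (p l).1.1)‖ := by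
            congr 1; abel
        _ ≤ ‖codeCLM C z‖ + ‖x₀ - vecOf (p J).2‖ + ‖vecOf (p J).2 - vecOf (p l).1.1‖ :=
            norm_add₃_le
        _ < _ := by linarith
    refine ⟨hU, (norm_comp_codeCLM_sub_id_le _ _).trans ?_⟩
    have hv := hc.sound (hUX hU) (isNamePrefix_shift hpx (k := s - 1) (by
      rw [add_sub_cancel_left]
      exact hz'.le.trans (pow_le_pow_of_le_one (by norm_num) (by norm_num) (Nat.sub_le s 1)))) h1
    refine (entrySum_le_defect v i C hv).trans ?_
    have : (defect v i C : ℝ) < ((1 / 2 : ℚ) : ℝ) := by exact_mod_cast h2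
    exact this.le.trans_eq (by norm_num)
  have hUX' : (U : Set (E n)) ⊆ X := hUX
  obtain ⟨-, G, hG₀, hG, hGf⟩ := exists_local_inverse U.isOpen (hf.mono hUX')
    ((continuousOn_fderiv hc.continuousOn).mono hUX') (by positivity) hmem
  exact ⟨_, isLocalRightInverse_of_inverse (by linarith) (fun z hz => (hmem z hz).1) hG₀ hG hGf⟩

/-- Every condition is a strict inequality or a finite output that appears eventually. The matrix
and the precision are fixed before the prefix length `s`, and `k` is chosen last because it depends
on `s`. -/
theorem RadiusEvidence.complete
    (hc : Computes h' (X : Set (E n)) fun x => matVec (jacobian f x))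
    {U : TopologicalSpace.Opens (E n)} {x₀ : E n} (hUX : U ≤ X) (hx₀ : x₀ ∈ U)
    (hrank : (jacobian f x₀).rank = m)
    {p : ℕ → ((Fin n → RatCode) × RatCode) × (Fin n → RatCode)}
    (hp : prodRep (openRep n) (cauchyRep n) p (U, x₀)) :
    ∃ s k, RadiusEvidence h' (pre p s) k := by
  obtain ⟨hpU, hpx⟩ := hp
  obtain ⟨N, hN⟩ := exists_right_inverse_of_rank hrank
  obtain ⟨C, hC⟩ := exists_codeMat_entrySum_lt hN (ε := 1 / 2) (by norm_num)
  obtain ⟨i, hi⟩ := exists_defect_lt hC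
  obtain ⟨q, hq, hqx⟩ := hc.2 _ x₀ (cauchyRep_shift hpx) (hUX hx₀)
  obtain ⟨s₀, hs₀⟩ := hq i
  have hx₀' : x₀ ∈ (U : Set (E n)) := hx₀
  rw [show (U : Set (E n)) = _ from hpU] at hx₀'
  obtain ⟨l, hl⟩ := Set.mem_iUnion.1 hx₀'
  rw [Metric.mem_ball, dist_eq_norm] at hl
  -- A third of the gap each for the distance from `x₀` to the entry `J`, for the subtracted `2⁻¹ ^
  -- J`, and for `2⁻¹ ^ s`.
  obtain ⟨J, hJ⟩ := exists_two_inv_pow_lt (ε := (ratOf (p l).1.2 - ‖x₀ - vecOf (p l).1.1‖) / 3)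
    (by linarith)
  let s := max (s₀ + 1) (max (J + 1) (l + 1))
  have hsJ : J < s := (Nat.lt_succ_self J).trans_le ((le_max_left _ _).trans (le_max_right _ _))
  have hsl : l < s := (Nat.lt_succ_self l).trans_le ((le_max_right _ _).trans (le_max_right _ _))
  have hss : s₀ ≤ s - 1 := Nat.le_sub_of_add_le (le_max_left _ _)
  have hpow : (2 : ℝ)⁻¹ ^ s ≤ 2⁻¹ ^ J := pow_le_pow_of_le_one (by norm_num) (by norm_num) hsJ.le
  obtain ⟨k, hk⟩ : ∃ k, 2 * codeSum C * 2⁻¹ ^ k < (2 : ℚ)⁻¹ ^ s := by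
    have h0 : 0 ≤ codeSum C :=
      Finset.sum_nonneg fun _ _ => Finset.sum_nonneg fun _ _ => abs_nonneg _
    -- The added 1 keeps the denominator positive when `C` is zero.
    obtain ⟨k, hk⟩ := exists_pow_lt_of_lt_one (y := (2 : ℚ)⁻¹)
      (show 0 < (2 : ℚ)⁻¹ ^ s / (2 * codeSum C + 1) by positivity) (by norm_num)
    rw [lt_div_iff₀ (by positivity)] at hk
    have : (0 : ℚ) < 2⁻¹ ^ k := by positivity
    exact ⟨k, by nlinarith⟩
  refine ⟨s, k, ⟨⟨i, q i, C⟩, ⟨J, p J⟩, ⟨l, p l⟩⟩, ?_, ?_, pre_getElem?_eq_some.2 ⟨hsJ, rfl⟩,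
    pre_getElem?_eq_some.2 ⟨hsl, rfl⟩, ?_, ?_⟩
  · rw [map_pre, tail_pre]
    exact hc.1 _ _ _ _ (pre_prefix _ hss) hs₀
  · have := hi (q i) (hqx i)
    have h2 : (defect (q i) i C : ℝ) < ((1 / 2 : ℚ) : ℝ) := by simpa using this
    exact_mod_cast h2
  · rw [pre_length]
    push_cast
    have h7 := hpx J
    have h8 := norm_sub_le_norm_sub_add_norm_sub (vecOf (p J).2) x₀ (vecOf (p l).1.1)
    rw [norm_sub_rev _ x₀] at h8
    simp only at h7 h8 ⊢
    linarith
  · rw [pre_length]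
    exact hk

theorem multiComputable_radiusRel (hf : HasComputableDeriv (X : Set (E n)) f) :
    MultiComputable (prodRep (openRep n) (cauchyRep n)) natRep (radiusRel X f) := by
  obtain ⟨hd, hcomp⟩ := hf
  obtain ⟨h', hh', hc⟩ := isComputableFun_iff.1 hcomp
  -- A name of a natural number is read only in cell 0, so the search need not depend on the output
  -- cell.
  obtain ⟨h, hh, hm, hs⟩ := exists_search
    (T := fun w (_ : ℕ) k => RadiusEvidence h' w k) (semiDec_radiusEvidence hh')
  refine ⟨h, hh, hm, ?_⟩
  rintro p ⟨U, x₀⟩ hp ⟨-, hx₀, hUX, hrank, -⟩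
  obtain ⟨q, hq, hT⟩ := hs p fun _ => RadiusEvidence.complete hc hUX hx₀ hrank hp
  obtain ⟨s, hs⟩ := hT 0
  exact ⟨q, q 0, hq, rfl, hx₀, hUX, hrank, RadiusEvidence.sound hd hc hUX hp hs⟩

theorem exists_radiusRel (hf : HasComputableDeriv (X : Set (E n)) f)
    {U : TopologicalSpace.Opens (E n)} {x₀ : E n} (hx₀ : x₀ ∈ U) (hUX : U ≤ X)
    (hrank : (jacobian f x₀).rank = m) : ∃ k, radiusRel X f (U, x₀) k := by
  obtain ⟨hd, hcomp⟩ := hf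
  obtain ⟨h', -, hc⟩ := isComputableFun_iff.1 hcomp
  have hUX' : (U : Set (E n)) ⊆ X := hUX
  have hcont := (continuousOn_fderiv hc.continuousOn).mono hUX'
  obtain ⟨C, r, hr, h⟩ := exists_ball_near_id U.isOpen hcont hx₀ hrank
  obtain ⟨-, G, hG₀, hG, hGf⟩ := exists_local_inverse U.isOpen (hd.mono hUX') hcont hr h
  obtain ⟨k, hk⟩ := exists_two_inv_pow_lt (half_pos hr)
  exact ⟨k, hx₀, hUX, hrank, _,
    isLocalRightInverse_of_inverse hk.le (fun z hz => (h z hz).1) hG₀ hG hGf⟩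

end Radius

/-! ### Computability of the local right inverse and of its derivative -/

section InverseFunction

variable {n m : ℕ}

theorem codeCLM_vecOf_apply {a b : ℕ} (C : Fin (a * b) → RatCode) (z : Fin b → RatCode)
    (i : Fin a) : codeCLM C (vecOf z) i = ((∑ j, entry C i j * ratOf (z j) : ℚ) : ℝ) := by
  rw [codeCLM, matCLM_apply]
  simp [codeMat, vecOf]

/-- Computable names of the points `x₀ + C z`, for rational `z`. -/
theorem exists_names_affine {c : ℕ → Fin n → RatCode} (hc : Computable c)
    (C : Fin (n * m) → RatCode) :
    ∃ P : (Fin m → RatCode) → ℕ → Fin n → RatCode, Computable₂ P ∧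
      ∀ z t, vecOf (P z t) = vecOf (c t) + codeCLM C (vecOf z) := by
  obtain ⟨P, hP, hPe⟩ := RatComputable.exists_vec (σ := (Fin m → RatCode) × ℕ) (n := n)
    (φ := fun i s => ratOf (c s.2 i) + ∑ j, entry C i j * ratOf (s.1 j)) fun i =>
      .add (.of_code (computable_apply (hc.comp Computable.snd) i)) <| .sum fun j =>
        .mul (.const _) (.of_code (computable_apply Computable.fst j))
  refine ⟨fun z t => P (z, t), hP, fun z t => ?_⟩
  ext i
  rw [PiLp.add_apply, codeCLM_vecOf_apply]
  simp only [vecOf, hPe]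
  push_cast
  rfl

/-- The product with a fixed rational matrix is computable on codes. -/
theorem exists_code_mul (C : Fin (n * m) → RatCode) :
    ∃ P : (Fin (m * m) → RatCode) → Fin (n * m) → RatCode, Computable P ∧
      ∀ N, codeMat (P N) = codeMat C * codeMat N := by
  obtain ⟨P, hP, hPe⟩ := RatComputable.exists_vec (σ := Fin (m * m) → RatCode) (n := n * m)
    (φ := fun k N => ∑ l, entry C (finProdFinEquiv.symm k).1 l *
      entry N l (finProdFinEquiv.symm k).2) fun k => .sum fun l =>
        .mul (.const _) (ratComputable_entry Computable.id _ _)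
  refine ⟨P, hP, fun N => ?_⟩
  ext i k
  rw [Matrix.mul_apply]
  simp only [codeMat, Matrix.of_apply]
  rw [entry, hPe, Equiv.symm_apply_apply]
  push_cast
  rfl

theorem vecOf_zero_code : vecOf (n := n) (fun _ => (0, 0, 0)) = 0 := by
  ext i
  simp [vecOf, ratOf]

/-- Rational points `z` with `f (x₀ + C z)` near `y` exist by density and continuity. Whichever one
the search finds, `hexp` turns closeness of values into closeness of `z` to `G y`. -/
theorem isComputableFun_inverse {f : E n → E m} {U : Set (E n)} (hf : IsComputableFun U f)
    {x₀ : E n} (hx₀ : IsComputablePt x₀) (C : Fin (n * m) → RatCode) (ρ : ℚ)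
    (hU : ∀ z ∈ Metric.ball (0 : E m) ρ, x₀ + codeCLM C z ∈ U)
    (hexp : ∀ z ∈ Metric.ball (0 : E m) ρ, ∀ z' ∈ Metric.ball (0 : E m) ρ,
      ‖z - z'‖ ≤ 2 * ‖f (x₀ + codeCLM C z) - f (x₀ + codeCLM C z')‖)
    {Y : Set (E m)} {G : E m → E m}
    (hG : ∀ y ∈ Y, G y ∈ Metric.ball (0 : E m) ρ ∧ f (x₀ + codeCLM C (G y)) = y) :
    IsComputableFun Y fun y => x₀ + codeCLM C (G y) := by
  obtain ⟨h, hh, hc⟩ := isComputableFun_iff.1 hf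
  obtain ⟨c, hcc, hcx⟩ := hx₀
  obtain ⟨P, hP, hPe⟩ := exists_names_affine (m := m) hcc C
  have hPname : ∀ z, cauchyRep n (P z) (x₀ + codeCLM C (vecOf z)) := fun z t => by
    rw [hPe, add_sub_add_right_eq_sub]
    exact hcx t
  -- Chosen so that `‖C‖ * 2 * 2⁻¹ ^ (j + e) ≤ 2⁻¹ ^ (j + 1)`, half the error allowed in cell `j`.
  -- The other half goes to the approximation of `x₀`, whence the index `j + 1` in `P`.
  obtain ⟨e, he⟩ := exists_two_inv_pow_lt
    (show (0 : ℝ) < 1 / (4 * ‖codeCLM C‖ + 1) by positivity)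
  rw [lt_div_iff₀ (by positivity)] at he
  let T : List (Fin m → RatCode) → ℕ → (Fin n → RatCode) → Prop := fun w j b =>
    ∃ t : (Fin m → RatCode) × ℕ × (Fin m → RatCode) × ℕ × (Fin m → RatCode),
      -- The output approximates `f (x₀ + C z)` and the input entry approximates `y`, each to within
      -- `2⁻¹ ^ i`; subtracting both errors guarantees that `f (x₀ + C z)` is within `2⁻¹ ^ (j + e)`
      -- of `y`.
      h (pre (P t.1) t.2.2.2.1) t.2.1 = some t.2.2.1 ∧ w[t.2.1]? = some t.2.2.2.2 ∧
      ‖vecOf t.2.2.1 - vecOf t.2.2.2.2‖ < ((2⁻¹ ^ (j + e) - 2 * 2⁻¹ ^ t.2.1 : ℚ) : ℝ) ∧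
      ‖vecOf t.1 - vecOf fun _ => (0, 0, 0)‖ < (ρ : ℝ) ∧ b = P t.1 (j + 1)
  have hT : SemiDec fun x : List (Fin m → RatCode) × ℕ × (Fin n → RatCode) =>
      T x.1 x.2.1 x.2.2 := by
    refine SemiDec.ex ?_
    have hx := (Computable.fst : Computable
      fun y : (List (Fin m → RatCode) × ℕ × (Fin n → RatCode)) ×
        ((Fin m → RatCode) × ℕ × (Fin m → RatCode) × ℕ × (Fin m → RatCode)) => y.1)
    have ht := (Computable.snd : Computable
      fun y : (List (Fin m → RatCode) × ℕ × (Fin n → RatCode)) ×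
        ((Fin m → RatCode) × ℕ × (Fin m → RatCode) × ℕ × (Fin m → RatCode)) => y.2)
    have hj := Computable.fst.comp (Computable.snd.comp hx)
    have hz := Computable.fst.comp ht
    have hi := Computable.fst.comp (Computable.snd.comp ht)
    have hv := Computable.fst.comp (Computable.snd.comp (Computable.snd.comp ht))
    have hk := Computable.fst.comp
      (Computable.snd.comp (Computable.snd.comp (Computable.snd.comp ht)))
    have ha := Computable.snd.comp
      (Computable.snd.comp (Computable.snd.comp (Computable.snd.comp ht)))
    exact .and (.eq (hh.comp ((computable_pre hP).comp hz hk) hi)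
        (Computable.option_some.comp hv)) <|
      .and (.eq (Computable.list_getElem?.comp (Computable.fst.comp hx) hi)
        (Computable.option_some.comp ha)) <|
      .and (semiDec_norm_sub_lt hv ha
        ((RatComputable.two_inv_pow (Primrec.nat_add.to_comp.comp hj (Computable.const e))).sub
          ((RatComputable.const 2).mul (.two_inv_pow hi)))) <|
      .and (semiDec_norm_sub_lt hz (Computable.const _) (.const ρ)) <|
      .eq (Computable.snd.comp (Computable.snd.comp hx)) (hP.comp hz (Computable.succ.comp hj))
  obtain ⟨g, hg, hgm, hgs⟩ := exists_search hT
  refine isComputableFun_iff.2 ⟨g, hg, hgm, fun p y hp hy => ?_⟩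
  obtain ⟨hGρ, hGy⟩ := hG y hy
  obtain ⟨q, hq, hqT⟩ := hgs p fun j => by
    have hε : (0 : ℝ) < 2⁻¹ ^ (j + e) := by positivity
    have hopen : IsOpen (Metric.ball (0 : E m) ρ ∩
        (fun z => f (x₀ + codeCLM C z)) ⁻¹' Metric.ball y (2⁻¹ ^ (j + e) / 2)) :=
      (hc.continuousOn.comp (by fun_prop) hU).isOpen_inter_preimage Metric.isOpen_ball
        Metric.isOpen_ball
    obtain ⟨z, hz, hzy⟩ := (denseRange_vecOf m).exists_mem_open hopen
      ⟨G y, hGρ, by simp [hGy]⟩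
    -- The total 1/8 + 1/2 + 1/8 stays within the 1 - 2/8 that the test leaves.
    obtain ⟨i, hi⟩ := exists_two_inv_pow_lt (show (0 : ℝ) < 2⁻¹ ^ (j + e) / 8 by positivity)
    obtain ⟨v, hv, hvx⟩ := hc.2 _ _ (hPname z) (hU _ hz)
    obtain ⟨k, hk⟩ := hv i
    refine ⟨i + 1, P z (j + 1), ⟨z, i, v i, k, p i⟩, hk,
      pre_getElem?_eq_some.2 ⟨Nat.lt_succ_self i, rfl⟩, ?_, ?_, rfl⟩
    · have h1 := hvx i
      have h2 := hp i
      rw [Set.mem_preimage, Metric.mem_ball, dist_eq_norm] at hzy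
      rw [norm_sub_rev] at h1
      push_cast
      calc ‖vecOf (v i) - vecOf (p i)‖
          = ‖(vecOf (v i) - f (x₀ + codeCLM C (vecOf z))) + (f (x₀ + codeCLM C (vecOf z)) - y) +
              (y - vecOf (p i))‖ := by congr 1; abel
        _ ≤ _ := norm_add₃_le
        _ < _ := by linarith
    · rw [vecOf_zero_code]
      simpa using hz
  refine ⟨q, hq, fun j => ?_⟩
  obtain ⟨s, ⟨z, i, v, k, a⟩, h1, h2, h3, h4, h5⟩ := hqT j
  simp only at h1 h2 h3 h4 h5
  obtain ⟨-, rfl⟩ := pre_getElem?_eq_some.1 h2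
  have hz : vecOf z ∈ Metric.ball (0 : E m) ρ := by
    rw [vecOf_zero_code] at h4
    simpa using h4
  have h6 := hc.sound (hU _ hz) (isNamePrefix_pre (hPname z) k) h1
  have h7 := hp i
  push_cast at h3
  have h8 : ‖G y - vecOf z‖ ≤ 2 * 2⁻¹ ^ (j + e) := by
    refine (hexp _ hGρ _ hz).trans (mul_le_mul_of_nonneg_left ?_ zero_le_two)
    rw [hGy, norm_sub_rev]
    calc ‖f (x₀ + codeCLM C (vecOf z)) - y‖
        = ‖(f (x₀ + codeCLM C (vecOf z)) - vecOf v) + (vecOf v - vecOf (p i)) -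
            (y - vecOf (p i))‖ := by congr 1; abel
      _ ≤ ‖f (x₀ + codeCLM C (vecOf z)) - vecOf v‖ + ‖vecOf v - vecOf (p i)‖ +
            ‖y - vecOf (p i)‖ := (norm_sub_le _ _).trans (by gcongr; exact norm_add_le _ _)
      _ ≤ _ := by linarith
  have h9 : ‖codeCLM C (G y - vecOf z)‖ ≤ 2⁻¹ ^ (j + 1) := by
    have hj : (0 : ℝ) < 2⁻¹ ^ j := by positivity
    calc ‖codeCLM C (G y - vecOf z)‖ ≤ ‖codeCLM C‖ * (2 * 2⁻¹ ^ (j + e)) :=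
          (codeCLM C).le_opNorm_of_le h8
      _ = 2⁻¹ ^ j * (2⁻¹ ^ e * (4 * ‖codeCLM C‖ + 1) - 2⁻¹ ^ e) * (1 / 2) := by
          rw [pow_add]; ring
      _ ≤ 2⁻¹ ^ j * 1 * (1 / 2) := by
          have : (0 : ℝ) < 2⁻¹ ^ e := by positivity
          gcongr
          linarith
      _ = 2⁻¹ ^ (j + 1) := by rw [pow_succ]; ring
  rw [h5, hPe]
  calc ‖x₀ + codeCLM C (G y) - (vecOf (c (j + 1)) + codeCLM C (vecOf z))‖
      = ‖(x₀ - vecOf (c (j + 1))) + codeCLM C (G y - vecOf z)‖ := by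
        rw [map_sub]; congr 1; abel
    _ ≤ _ := norm_add_le _ _
    _ < 2⁻¹ ^ (j + 1) + 2⁻¹ ^ (j + 1) := add_lt_add_of_lt_of_le (hcx (j + 1)) h9
    _ = 2⁻¹ ^ j := by rw [pow_succ]; ring

/-- Used to feed a finite part of one machine's output into another machine. -/
theorem Produces.exists_stage {α β : Type} {h : List α → ℕ → Option β} (hm : IsMonotoneWord h)
    {p : ℕ → α} {q : ℕ → β} (hq : Produces h p q) (k : ℕ) :
    ∃ s, ∀ t < k, h (pre p s) t = some (q t) := by
  induction k with
  | zero => exact ⟨0, fun t ht => by omega⟩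
  | succ k ih =>
    obtain ⟨s, hs⟩ := ih
    obtain ⟨s', hs'⟩ := hq k
    refine ⟨max s s', fun t ht => ?_⟩
    rcases Nat.lt_succ_iff_lt_or_eq.1 ht with h1 | rfl
    · exact hm _ _ _ _ (pre_prefix p (le_max_left _ _)) (hs t h1)
    · exact hm _ _ _ _ (pre_prefix p (le_max_right _ _)) hs'

/-- Write `T - D = M (T - D) - (M - id) (T - D)` and absorb the last term. When `M D = id`, this
bounds the error of an approximate inverse `T` by twice its residual. -/
theorem norm_sub_le_of_near_id {V W : Type*} [NormedAddCommGroup V] [NormedSpace ℝ V]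
    [NormedAddCommGroup W] [NormedSpace ℝ W] {M : V →L[ℝ] V} {D T : W →L[ℝ] V}
    (hM : ‖M - ContinuousLinearMap.id ℝ V‖ ≤ 1 / 2) : ‖T - D‖ ≤ 2 * ‖M.comp T - M.comp D‖ := by
  have h1 : T - D = (M.comp T - M.comp D) - (M - ContinuousLinearMap.id ℝ V).comp (T - D) := by
    ext x
    simp
    abel
  have h2 := norm_sub_le (M.comp T - M.comp D) ((M - ContinuousLinearMap.id ℝ V).comp (T - D))
  rw [← h1] at h2
  have h3 := (M - ContinuousLinearMap.id ℝ V).opNorm_comp_le (T - D)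
  have h4 := mul_le_mul_of_nonneg_right hM (norm_nonneg (T - D))
  linarith

/-- The chain rule gives `g' = C * D` with `D` a right inverse of `f' (g y) * C`. No inverse is
computed: any rational `N` with small residual is close to `D`, and the output is the code of `C *
N`. -/
theorem isComputableFun_jacobian_inverse {f : E n → E m} {U : Set (E n)}
    (hf : IsComputableFun U fun x => matVec (jacobian f x)) (C : Fin (n * m) → RatCode)
    {Y : Set (E m)} {g : E m → E n} (hg : IsComputableFun Y g) (hgU : Set.MapsTo g Y U)
    {D : E m → E m →L[ℝ] E m}
    (hD : ∀ y ∈ Y, fderiv ℝ g y = (codeCLM C).comp (D y) ∧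
      ((fderiv ℝ f (g y)).comp (codeCLM C)).comp (D y) = ContinuousLinearMap.id ℝ (E m) ∧
      ‖(fderiv ℝ f (g y)).comp (codeCLM C) - ContinuousLinearMap.id ℝ (E m)‖ ≤ 1 / 2) :
    IsComputableFun Y fun y => matVec (jacobian g y) := by
  obtain ⟨h', hh', hc'⟩ := isComputableFun_iff.1 hf
  obtain ⟨hg, hhg, hcg⟩ := isComputableFun_iff.1 hg
  obtain ⟨P, hP, hPe⟩ := exists_code_mul C
  -- The factor `n * m` is the cost of passing from the operator norm to the vector of entries,
  -- `‖C‖` that of multiplying by `C`, and 2 that of passing from residual to error.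
  obtain ⟨e, he⟩ := exists_two_inv_pow_lt
    (show (0 : ℝ) < 1 / ((n * m : ℕ) * (‖codeCLM C‖ * 2) + 1) by positivity)
  rw [lt_div_iff₀ (by positivity)] at he
  let T : List (Fin m → RatCode) → ℕ → (Fin (n * m) → RatCode) → Prop := fun w j b =>
    ∃ t : List (Fin n → RatCode) × ℕ × (Fin (m * n) → RatCode) × (Fin (m * m) → RatCode),
      -- The word `t.1` is what the machine for `g` has already written on input `w`, hence a prefix
      -- of a name of `g y`, and is passed to the machine for `f'`.
      pre (hg w) t.1.length = t.1.map some ∧ h' t.1 t.2.1 = some t.2.2.1 ∧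
      defect t.2.2.1 t.2.1 b < 2⁻¹ ^ (j + e) ∧ b = P t.2.2.2
  have hT : SemiDec fun x : List (Fin m → RatCode) × ℕ × (Fin (n * m) → RatCode) =>
      T x.1 x.2.1 x.2.2 := by
    refine SemiDec.ex ?_
    have hx := (Computable.fst : Computable
      fun y : (List (Fin m → RatCode) × ℕ × (Fin (n * m) → RatCode)) ×
        (List (Fin n → RatCode) × ℕ × (Fin (m * n) → RatCode) × (Fin (m * m) → RatCode)) => y.1)
    have ht := (Computable.snd : Computable
      fun y : (List (Fin m → RatCode) × ℕ × (Fin (n * m) → RatCode)) ×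
        (List (Fin n → RatCode) × ℕ × (Fin (m * n) → RatCode) × (Fin (m * m) → RatCode)) => y.2)
    have hj := Computable.fst.comp (Computable.snd.comp hx)
    have hb := Computable.snd.comp (Computable.snd.comp hx)
    have hu := Computable.fst.comp ht
    have hi := Computable.fst.comp (Computable.snd.comp ht)
    have hv := Computable.fst.comp (Computable.snd.comp (Computable.snd.comp ht))
    have hN := Computable.snd.comp (Computable.snd.comp (Computable.snd.comp ht))
    have hmap : Primrec fun u : List (Fin n → RatCode) => u.map some :=
      Primrec.list_map Primrec.id (Primrec.option_some.comp Primrec.snd).to₂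
    exact .and (.eq ((computable_pre hhg).comp (Computable.fst.comp hx)
        (Computable.list_length.comp hu)) (hmap.to_comp.comp hu)) <|
      .and (.eq (hh'.comp hu hi) (Computable.option_some.comp hv)) <|
      .and (RatComputable.semiDec_lt (ratComputable_defect hv hi hb)
        (.two_inv_pow (Primrec.nat_add.to_comp.comp hj (Computable.const e)))) <|
      .eq hb (hP.comp hN)
  obtain ⟨H, hH, hHm, hHs⟩ := exists_search hT
  refine isComputableFun_iff.2 ⟨H, hH, hHm, fun p y hp hy => ?_⟩
  obtain ⟨hgD, hinv, hnear⟩ := hD y hy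
  obtain ⟨q, hq, hqT⟩ := hHs p fun j => by
    have hinv' : jacobian f (g y) * codeMat C * clmMat (D y) = 1 := by
      have := congrArg clmMat hinv
      rwa [clmMat_comp, clmMat_comp, clmMat_id, codeCLM, clmMat_matCLM] at this
    obtain ⟨N, hN⟩ := exists_codeMat_entrySum_lt hinv' (ε := 2⁻¹ ^ (j + e)) (by positivity)
    rw [Matrix.mul_assoc, ← hPe] at hN
    obtain ⟨i, hi⟩ := exists_defect_lt hN
    obtain ⟨u, hu, hux⟩ := hcg.2 p y hp hy
    obtain ⟨v, hv, hvx⟩ := hc'.2 u _ hux (hgU hy)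
    obtain ⟨k, hk⟩ := hv i
    obtain ⟨s, hs⟩ := hu.exists_stage hcg.1 k
    refine ⟨s, P N, ⟨pre u k, i, v i, N⟩, ?_, hk, ?_, rfl⟩
    · rw [pre_length, map_pre]
      exact List.map_congr_left fun t ht => hs t (List.mem_range.1 ht)
    · have h2 : (defect (v i) i (P N) : ℝ) < ((2⁻¹ ^ (j + e) : ℚ) : ℝ) := by
        push_cast
        exact hi _ (hvx i)
      exact_mod_cast h2
  refine ⟨q, hq, fun j => ?_⟩
  obtain ⟨s, ⟨u, i, v, N⟩, h1, h2, h3, h4⟩ := hqT j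
  simp only at h1 h2 h3 h4
  have hu : IsNamePrefix u (g y) := by
    intro t b hb
    refine hcg.sound hy (isNamePrefix_pre hp s) ?_
    have h5 : (pre (hg (pre p s)) u.length)[t]? = some (some b) := by
      rw [h1, List.getElem?_map, hb]; rfl
    exact (pre_getElem?_eq_some.1 h5).2
  have hv := hc'.sound (hgU hy) hu h2
  have hlt : entrySum (jacobian f (g y) * codeMat (q j) - 1) < 2⁻¹ ^ (j + e) := by
    refine (entrySum_le_defect v i (q j) hv).trans_lt ?_
    have := (Rat.cast_lt (K := ℝ)).2 h3
    push_cast at this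
    exact this
  have hTN : ‖codeCLM N - D y‖ ≤ 2 * 2⁻¹ ^ (j + e) := by
    refine (norm_sub_le_of_near_id hnear).trans (mul_le_mul_of_nonneg_left ?_ zero_le_two)
    rw [hinv]
    refine (norm_comp_codeCLM_sub_id_le _ _).trans (le_of_eq_of_le ?_ hlt.le)
    rw [clmMat_comp, codeCLM, clmMat_matCLM, Matrix.mul_assoc, ← hPe, ← h4]
    rfl
  have hfinal : matVec (jacobian g y) - vecOf (q j) =
      matVec (clmMat ((codeCLM C).comp (D y - codeCLM N))) := by
    rw [← matVec_codeMat, ← matVec_sub, h4, hPe, ContinuousLinearMap.comp_sub, ← hgD,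
      clmMat_sub, clmMat_comp, codeCLM, codeCLM, clmMat_matCLM, clmMat_matCLM]
    rfl
  have hj : (0 : ℝ) < 2⁻¹ ^ j := by positivity
  have he' : (0 : ℝ) < 2⁻¹ ^ e := by positivity
  rw [hfinal]
  calc ‖matVec (clmMat ((codeCLM C).comp (D y - codeCLM N)))‖
      ≤ (n * m : ℕ) * ‖(codeCLM C).comp (D y - codeCLM N)‖ := norm_matVec_le _
    _ ≤ (n * m : ℕ) * (‖codeCLM C‖ * (2 * 2⁻¹ ^ (j + e))) := by
        gcongr
        refine ((codeCLM C).opNorm_comp_le _).trans ?_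
        rw [norm_sub_rev]
        gcongr
    _ = 2⁻¹ ^ j * (2⁻¹ ^ e * ((n * m : ℕ) * (‖codeCLM C‖ * 2) + 1) - 2⁻¹ ^ e) := by
        rw [pow_add]; ring
    _ < 2⁻¹ ^ j * 1 := by
        gcongr
        linarith
    _ = 2⁻¹ ^ j := mul_one _

theorem exists_computable_local_inverse {U : TopologicalSpace.Opens (E n)} {f : E n → E m}
    {x₀ : E n} (hf : IsComputableFun (U : Set (E n)) f)
    (hf' : HasComputableDeriv (U : Set (E n)) f) (hxU : x₀ ∈ U) (hx₀ : IsComputablePt x₀)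
    (hrank : (jacobian f x₀).rank = m) :
    ∃ (δ : ℚ) (g : E m → E n), 0 < δ ∧ IsLocalRightInverse f (U : Set (E n)) x₀ (δ : ℝ) g ∧
      IsComputableFun (Metric.ball (f x₀) (δ : ℝ)) g ∧
      HasComputableDeriv (Metric.ball (f x₀) (δ : ℝ)) g := by
  obtain ⟨hd, hcomp⟩ := hf'
  obtain ⟨h', -, hc⟩ := isComputableFun_iff.1 hcomp
  have hcont := continuousOn_fderiv hc.continuousOn
  obtain ⟨C, r, hr, hball⟩ := exists_ball_near_id U.isOpen hcont hxU hrank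
  -- A rational radius lets the search semidecide whether a rational `z` lies in the ball. Both `C`
  -- and `ρ` are fixed finite data that the machines may contain.
  obtain ⟨ρ, hρ, hρr⟩ := exists_rat_btwn hr
  replace hball := fun z hz => hball z (Metric.ball_subset_ball hρr.le hz)
  obtain ⟨hexp, G, hG₀, hG, hGf⟩ := exists_local_inverse U.isOpen hd hcont hρ hball
  have hδ : ((ρ / 2 : ℚ) : ℝ) = ρ / 2 := by push_cast; rfl
  have hloc : IsLocalRightInverse f (U : Set (E n)) x₀ ((ρ / 2 : ℚ) : ℝ)
      fun y => x₀ + codeCLM C (G y) :=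
    isLocalRightInverse_of_inverse hδ.le (fun z hz => (hball z hz).1) hG₀ hG hGf
  rw [← hδ] at hG hGf
  have hg := isComputableFun_inverse hf hx₀ C ρ (fun z hz => (hball z hz).1) hexp hGf
  refine ⟨ρ / 2, _, half_pos (by exact_mod_cast hρ), hloc, hg,
    hloc.1.differentiableOn one_ne_zero, ?_⟩
  refine isComputableFun_jacobian_inverse hcomp C hg hloc.2.1 (D := fderiv ℝ G) fun y hy => ?_
  have hGd : HasFDerivAt G (fderiv ℝ G y) y :=
    ((hG.differentiableOn one_ne_zero).differentiableAt
      (Metric.isOpen_ball.mem_nhds hy)).hasFDerivAt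
  have hgd : HasFDerivAt (fun y => x₀ + codeCLM C (G y)) ((codeCLM C).comp (fderiv ℝ G y)) y :=
    ((codeCLM C).hasFDerivAt.comp y hGd).const_add x₀
  refine ⟨hgd.fderiv, ?_, (hball _ (hGf y hy).1).2⟩
  have hfd := (hd.differentiableAt (U.isOpen.mem_nhds (hball _ (hGf y hy).1).1)).hasFDerivAt
  -- Near `y` the composite `f ∘ g` is the identity, so uniqueness of derivatives gives the inverse
  -- relation.
  refine (hfd.comp y hgd).unique ((hasFDerivAt_id y).congr_of_eventuallyEq ?_)
  filter_upwards [Metric.isOpen_ball.mem_nhds hy] with y' hy'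
  exact (hGf y' hy').2

end InverseFunction

end TTE

theorem theorem4 (n m : ℕ) :
    (∀ (U : TopologicalSpace.Opens (TTE.E n)) (f : TTE.E n → TTE.E m) (x₀ : TTE.E n),
      TTE.IsREOpen U → TTE.IsComputableFun (U : Set (TTE.E n)) f →
      TTE.HasComputableDeriv (U : Set (TTE.E n)) f →
      x₀ ∈ U → TTE.IsComputablePt x₀ → (TTE.jacobian f x₀).rank = m →
      ∃ (δ : ℚ) (g : TTE.E m → TTE.E n), 0 < δ ∧
        TTE.IsLocalRightInverse f (U : Set (TTE.E n)) x₀ (δ : ℝ) g ∧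
        TTE.IsComputableFun (Metric.ball (f x₀) (δ : ℝ)) g ∧
        TTE.HasComputableDeriv (Metric.ball (f x₀) (δ : ℝ)) g) ∧
    (∀ (X : TopologicalSpace.Opens (TTE.E n)) (f : TTE.E n → TTE.E m),
      TTE.IsREOpen X → TTE.IsComputableFun (X : Set (TTE.E n)) f →
      ContDiffOn ℝ 1 f (X : Set (TTE.E n)) →
      TTE.HasComputableDeriv (X : Set (TTE.E n)) f →
      (∀ (U : TopologicalSpace.Opens (TTE.E n)) (x₀ : TTE.E n),
        x₀ ∈ U → U ≤ X → (TTE.jacobian f x₀).rank = m →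
        ∃ k : ℕ, TTE.radiusRel X f (U, x₀) k) ∧
      TTE.MultiComputable (TTE.prodRep (TTE.openRep n) (TTE.cauchyRep n)) TTE.natRep
        (TTE.radiusRel X f)) := by
  exact ⟨fun U f x₀ _ hf hf' hx hx₀ hrank =>
      TTE.exists_computable_local_inverse hf hf' hx hx₀ hrank,
    fun X f _ _ _ hf' => ⟨fun U x₀ hx hUX hrank => TTE.exists_radiusRel hf' hx hUX hrank,
      TTE.multiComputable_radiusRel hf'⟩⟩
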